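/- **Setting.** Let $\mu$ be a law on $\mathbb R^d$ with mean zero, finite second moments and covariance $\Sigma\succ0$, whose largest and smallest eigenvalues are $\lambda_{\max},\lambda_{\min}$. For a symmetric matrix $M\succ 0$ write $\langle u,v\rangle_M=u^\top Mv$, $\|u\|_M=\langle u,u\rangle_M^{1/2}$, $\cos_M(u,v)=\langle u,v\rangle_M/(\|u\|_M\|v\|_M)$ (with value $0$ if $u=0$ or $v=0$), and let $\mathrm{Proj}^{\Sigma}_{w^\perp}$ be the $\langle\cdot,\cdot\rangle_\Sigma$-orthogonal projection onto the $\langle\cdot,\cdot\rangle_\Sigma$-orthogonal complement of $w$; $\|\cdot\|$ is the Euclidean norm. For $\varepsilon\ge 0$, $\mu$ is *$\varepsilon$-elliptical along* a nontrivial subspace $E$ if for $x\sim\mu$, all $v\in E\setminus\{0\}$ and all $u$ with $u^\top\Sigma v=0$ one has $|\mathbb E[u^\top x\mid v^\top x]|\le\varepsilon\|u\|_\Sigma$ almost surely. Let $\beta>0$, $\sigma_\beta(s)=1/(1+e^{-\beta s})$, $\ell_\beta(\theta;x,1)=-\log\sigma_\beta(\theta^\top x)$, $\ell_\beta(\theta;x,0)=-\log(1-\sigma_\beta(\theta^\top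 x))$. Let $\theta^*,\psi,\theta_0\in\mathbb R^d$ with $\|\theta^*\|_\Sigma=\|\psi\|_\Sigma=1$, $\theta_0\ne0$, $\langle\theta^*,\theta_0\rangle_{\Sigma^2}\ge0$, $\langle\theta^*,\theta_0\rangle_\Sigma\ge0$ and $\langle\theta^*,\psi\rangle_{\Sigma^2}\ge0$. Put $L(\theta)=\mathbb E_{x\sim\mu}\,\ell_\beta(\theta;x,\mathbf 1[\psi^\top x\ge0])$, $\Psi(\theta)=\cos_\Sigma(\theta,\theta^*)$, $\tilde\theta_0=\theta_0/\|\theta_0\|_\Sigma$, $m=\mathbb E[\sigma_\beta(\theta_0^\top x)\,\tilde\theta_0^\top x]$, and $$\rho_\ell=\tfrac{\lambda_{\min}}2\,\mathbb E|\psi^\top x|\,\cos_\Sigma(\Sigma\theta^*,\psi)-m\,\langle\Sigma\theta^*,\tilde\theta_0\rangle_\Sigma-2\lambda_{\max}\varepsilon,$$ $$\rho_\upsilon=m\,\big\langle\Sigma\,\mathrm{Proj}^\Sigma_{(\theta^*)^\perp}\tilde\theta_0,\tilde\theta_0\big\rangle_\Sigma-\tfrac{\lambda_{\max}}2\,\mathbb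 E|\psi^\top x|\,\big|\cos_\Sigma(\Sigma\,\mathrm{Proj}^\Sigma_{(\theta^*)^\perp}\theta_0,\psi)\big|-2\lambda_{\max}\varepsilon,$$ $$\rho=(1-\cos_\Sigma^2(\theta^*,\theta_0))\,\rho_\ell+\cos_\Sigma(\theta^*,\theta_0)\,\rho_\upsilon .$$ Further let $\gamma=\frac{\lambda_{\max}\beta^2}{\lambda_{\max}\beta^2+4}$, $\kappa=\frac2{\sqrt3}\frac{\lambda_{\max}}{\lambda_{\min}}+\frac{\beta^2}4\frac{\lambda_{\max}^{3/2}}{\lambda_{\min}^{1/2}}$, $G=\|\nabla L(\theta_0)\|$, and $$\alpha_*=\min\Big\{\frac{2\rho}{\lambda_{\max}^{3/2}\beta\|\theta_0\|}\log\Big(\frac{\gamma\|\theta_0\|}{G}+1\Big),\ \frac{\beta^2\rho^2\gamma^2}{2\lambda_{\max}\,\kappa\,(G+\gamma\|\theta_0\|)^2}\Big\},$$ $$\tau=\min\Big\{\frac4{\lambda_{\max}\beta^2}\log\Big(\frac{\gamma\|\theta_0\|}{G}+1\Big),\ \frac{\beta\rho\gamma^2\|\theta_0\|}{\lambda_{\max}^{1/2}\,\kappa\,(G+\gamma\|\theta_0\|)^2}\Big\},\qquad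 \delta=\frac{\gamma\|\theta_0\|\lambda_{\min}^{1/2}\alpha_*}{8\lambda_{\max}^{1/2}} .$$ For a step size $\eta$, batch size $B\ge1$ and i.i.d. samples $x^{(t)}_i\sim\mu$ ($0\le t<T$, $1\le i\le B$), the SGD iterates are $\hat\theta_0=\theta_0$, $\hat\theta_{t+1}=\hat\theta_t-\frac{\eta}{B}\sum_{i=1}^B\nabla_\theta\ell_\beta(\hat\theta_t;x^{(t)}_i,\mathbf 1[\psi^\top x^{(t)}_i\ge0])$. **Theorem.** There are absolute constants $c,C>0$ such that the following holds in the above setting. Suppose $\mu$ is $\varepsilon$-elliptical along $\mathrm{span}\{\psi,\theta_0\}$ and $\rho>0$. Let $T\ge1$ be an integer such that $\eta:=\tau/T$ satisfies $$\eta\le\delta\Big(\frac\gamma2\|\theta_0\|+\frac{\gamma^2}2\frac{\|\theta_0\|^2}{G}\Big)^{-1}.$$ Then $\Psi(\hat\theta_T)-\Psi(\theta_0)\ge c\,\alpha_*$ fails with probability at most $$\frac d{B\alpha_*}\cdot C\,\frac{\beta^2\lambda_{\max}+1}{\beta^2\lambda_{\min}}\Big(\frac1{\|\theta_0\|\,G}+\frac1{G^2}\Big).$$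 -/

import Mathlib

open MeasureTheory ProbabilityTheory
open scoped RealInnerProductSpace

namespace WeakToStrong

noncomputable section

/-- `ℝ^d` with the Euclidean inner product and norm. -/
abbrev Vec (d : ℕ) : Type := EuclideanSpace ℝ (Fin d)

/-! ### Geometry of a matrix `M` -/

/-- The vector `M v`. -/
def app {d : ℕ} (M : Matrix (Fin d) (Fin d) ℝ) (v : Vec d) : Vec d :=
  Matrix.toEuclideanLin M v

/-- `⟨u, v⟩_M = uᵀ M v`. -/
def innerM {d : ℕ} (M : Matrix (Fin d) (Fin d) ℝ) (u v : Vec d) : ℝ :=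
  ⟪u, app M v⟫

/-- `‖u‖_M = √⟨u, u⟩_M`. -/
def normM {d : ℕ} (M : Matrix (Fin d) (Fin d) ℝ) (u : Vec d) : ℝ :=
  Real.sqrt (innerM M u u)

/-- `cos_M(u, v) = ⟨u, v⟩_M / (‖u‖_M ‖v‖_M)`. -/
def cosM {d : ℕ} (M : Matrix (Fin d) (Fin d) ℝ) (u v : Vec d) : ℝ :=
  innerM M u v / (normM M u * normM M v)

/-- The orthogonal projection of `v` onto the `⟨·, ·⟩_M`-orthogonal complement of `w ≠ 0`. -/
def projPerp {d : ℕ} (M : Matrix (Fin d) (Fin d) ℝ) (w v : Vec d) : Vec d :=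
  v - (innerM M w v / innerM M w w) • w

/-- The largest eigenvalue of a symmetric matrix. -/
def lamMax {d : ℕ} (M : Matrix (Fin d) (Fin d) ℝ) : ℝ := sSup (spectrum ℝ M)

/-- The smallest eigenvalue of a symmetric matrix. -/
def lamMin {d : ℕ} (M : Matrix (Fin d) (Fin d) ℝ) : ℝ := sInf (spectrum ℝ M)

/-! ### The data distribution -/

/-- The covariance matrix of a law `μ` on `ℝ^d`. -/
def covMat {d : ℕ} (μ : Measure (Vec d)) : Matrix (Fin d) (Fin d) ℝ :=
  Matrix.of fun i j => cov[fun x : Vec d => x i, fun x : Vec d => x j; μ]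

/-- A law `μ` on `ℝ^d` with mean zero and positive definite covariance `Σ` is `ε`-elliptical along
the nontrivial subspace `E` if `|𝔼[uᵀx | vᵀx]| ≤ ε ‖u‖_Σ` almost surely, for all nonzero `v ∈ E`
and all `u` with `uᵀ Σ v = 0`. -/
structure IsElliptical {d : ℕ} (μ : Measure (Vec d)) (ε : ℝ) (E : Submodule ℝ (Vec d)) : Prop where
  memLp_two : MemLp id 2 μ
  mean_zero : ∫ x, x ∂μ = 0
  posDef : (covMat μ).PosDef
  nontrivial : E ≠ ⊥
  abs_condExp_le : ∀ v ∈ E, v ≠ 0 → ∀ u : Vec d, innerM (covMat μ) u v = 0 →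
    ∀ᵐ x ∂μ,
      |(μ[fun z : Vec d => ⟪u, z⟫ |
          MeasurableSpace.comap (fun z : Vec d => ⟪v, z⟫) inferInstance]) x|
        ≤ ε * normM (covMat μ) u

/-! ### Logistic loss and supervised finetuning -/

/-- The logistic function `σ_β(s) = 1 / (1 + exp (-β s))`. -/
def sigmoid (β s : ℝ) : ℝ := 1 / (1 + Real.exp (-(β * s)))

/-- The probability `p_θ(y | x)` of the label `y ∈ {0, 1}`, where `p_θ(1 | x) = σ_β(θᵀx)`. -/
def prob {d : ℕ} (β : ℝ) (θ x : Vec d) (y : Fin 2) : ℝ :=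
  if y = 1 then sigmoid β ⟪θ, x⟫ else 1 - sigmoid β ⟪θ, x⟫

/-- The logistic loss `-log p_θ(y | x)`. -/
def loss {d : ℕ} (β : ℝ) (θ x : Vec d) (y : Fin 2) : ℝ := -Real.log (prob β θ x y)

open Classical in
/-- The teacher's label `𝟙[ψᵀx ≥ 0]`. -/
def label {d : ℕ} (ψ x : Vec d) : Fin 2 := if 0 ≤ ⟪ψ, x⟫ then 1 else 0

/-- The population loss `L(θ) = 𝔼 loss(θ; x, 𝟙[ψᵀx ≥ 0])`. -/
def popLoss {d : ℕ} (μ : Measure (Vec d)) (β : ℝ) (ψ θ : Vec d) : ℝ :=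
  ∫ x, loss β θ x (label ψ x) ∂μ

/-- The minibatch gradient at `θ` on the batch `x 0, …, x (B - 1)` labelled by the teacher. -/
def batchGrad {d B : ℕ} (β : ℝ) (ψ : Vec d) (x : Fin B → Vec d) (θ : Vec d) : Vec d :=
  (1 / (B : ℝ)) • ∑ i, gradient (fun θ' => loss β θ' (x i) (label ψ (x i))) θ

/-- The SGD iterates on the batches `x 0, x 1, …`, started at `θ₀`, with step size `η`. -/
def sgd {d B : ℕ} (β η : ℝ) (ψ θ₀ : Vec d) (x : ℕ → Fin B → Vec d) : ℕ → Vec d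
  | 0 => θ₀
  | t + 1 => sgd β η ψ θ₀ x t - η • batchGrad β ψ (x t) (sgd β η ψ θ₀ x t)

/-! ### The quantities in the guarantee -/

/-- The confidence measure `m = 𝔼[σ_β(θ₀ᵀx) θ₀ᵀx] / ‖θ₀‖_Σ`. -/
def conf {d : ℕ} (μ : Measure (Vec d)) (β : ℝ) (θ₀ : Vec d) : ℝ :=
  1 / normM (covMat μ) θ₀ * ∫ x, sigmoid β ⟪θ₀, x⟫ * ⟪θ₀, x⟫ ∂μ

/-- The normalized student `θ₀ / ‖θ₀‖_Σ`. -/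
def unitStudent {d : ℕ} (μ : Measure (Vec d)) (θ₀ : Vec d) : Vec d :=
  (1 / normM (covMat μ) θ₀) • θ₀

/-- `𝔼 |ψᵀx|`. -/
def teacherScale {d : ℕ} (μ : Measure (Vec d)) (ψ : Vec d) : ℝ := ∫ x, |⟪ψ, x⟫| ∂μ

/-- The student's potential to learn the direction `θ*`. -/
def rhoL {d : ℕ} (μ : Measure (Vec d)) (β ε : ℝ) (θs ψ θ₀ : Vec d) : ℝ :=
  lamMin (covMat μ) / 2 * teacherScale μ ψ * cosM (covMat μ) (app (covMat μ) θs) ψ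
    - conf μ β θ₀ * innerM (covMat μ) (app (covMat μ) θs) (unitStudent μ θ₀)
    - 2 * lamMax (covMat μ) * ε

/-- The student's potential to unlearn its component orthogonal to `θ*`. -/
def rhoU {d : ℕ} (μ : Measure (Vec d)) (β ε : ℝ) (θs ψ θ₀ : Vec d) : ℝ :=
  conf μ β θ₀ *
      innerM (covMat μ) (app (covMat μ) (projPerp (covMat μ) θs (unitStudent μ θ₀)))
        (unitStudent μ θ₀)
    - lamMax (covMat μ) / 2 * teacherScale μ ψ *
      |cosM (covMat μ) (app (covMat μ) (projPerp (covMat μ) θs θ₀)) ψ|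
    - 2 * lamMax (covMat μ) * ε

/-- The signal `ρ = (1 - cos_Σ²(θ*, θ₀)) ρ_ℓ + cos_Σ(θ*, θ₀) ρ_υ`. -/
def rho {d : ℕ} (μ : Measure (Vec d)) (β ε : ℝ) (θs ψ θ₀ : Vec d) : ℝ :=
  (1 - cosM (covMat μ) θs θ₀ ^ 2) * rhoL μ β ε θs ψ θ₀
    + cosM (covMat μ) θs θ₀ * rhoU μ β ε θs ψ θ₀

/-- `‖∇L(θ₀)‖`. -/
def gradNorm {d : ℕ} (μ : Measure (Vec d)) (β : ℝ) (ψ θ₀ : Vec d) : ℝ :=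
  ‖gradient (popLoss μ β ψ) θ₀‖

/-- `γ = λmax β² / (λmax β² + 4)`. -/
def gam {d : ℕ} (μ : Measure (Vec d)) (β : ℝ) : ℝ :=
  lamMax (covMat μ) * β ^ 2 / (lamMax (covMat μ) * β ^ 2 + 4)

/-- `κ = (2/√3) λmax/λmin + (β²/4) λmax^{3/2}/λmin^{1/2}`. -/
def kap {d : ℕ} (μ : Measure (Vec d)) (β : ℝ) : ℝ :=
  2 / Real.sqrt 3 * (lamMax (covMat μ) / lamMin (covMat μ))
    + β ^ 2 / 4 * (lamMax (covMat μ) ^ (3 / 2 : ℝ) / lamMin (covMat μ) ^ (1 / 2 : ℝ))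

/-- The time horizon `τ`. -/
def tau {d : ℕ} (μ : Measure (Vec d)) (β ε : ℝ) (θs ψ θ₀ : Vec d) : ℝ :=
  min
    (4 / (lamMax (covMat μ) * β ^ 2) * Real.log (gam μ β * ‖θ₀‖ / gradNorm μ β ψ θ₀ + 1))
    (β * rho μ β ε θs ψ θ₀ * gam μ β ^ 2 * ‖θ₀‖ /
      (lamMax (covMat μ) ^ (1 / 2 : ℝ) * kap μ β *
        (gradNorm μ β ψ θ₀ + gam μ β * ‖θ₀‖) ^ 2))

/-- The guaranteed order of improvement `α_*`. -/
def alphaStar {d : ℕ} (μ : Measure (Vec d)) (β ε : ℝ) (θs ψ θ₀ : Vec d) : ℝ :=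
  min
    (2 * rho μ β ε θs ψ θ₀ / (lamMax (covMat μ) ^ (3 / 2 : ℝ) * β * ‖θ₀‖) *
      Real.log (gam μ β * ‖θ₀‖ / gradNorm μ β ψ θ₀ + 1))
    (β ^ 2 * rho μ β ε θs ψ θ₀ ^ 2 * gam μ β ^ 2 /
      (2 * lamMax (covMat μ) * kap μ β * (gradNorm μ β ψ θ₀ + gam μ β * ‖θ₀‖) ^ 2))

/-- `δ = γ ‖θ₀‖ λmin^{1/2} α_* / (8 λmax^{1/2})`. -/
def delta {d : ℕ} (μ : Measure (Vec d)) (β ε : ℝ) (θs ψ θ₀ : Vec d) : ℝ :=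
  gam μ β * ‖θ₀‖ * lamMin (covMat μ) ^ (1 / 2 : ℝ) * alphaStar μ β ε θs ψ θ₀ /
    (8 * lamMax (covMat μ) ^ (1 / 2 : ℝ))

/-- The step size threshold `δ (γ‖θ₀‖/2 + (γ²/2) ‖θ₀‖²/‖∇L(θ₀)‖)⁻¹`. -/
def etaMax {d : ℕ} (μ : Measure (Vec d)) (β ε : ℝ) (θs ψ θ₀ : Vec d) : ℝ :=
  delta μ β ε θs ψ θ₀ *
    (gam μ β / 2 * ‖θ₀‖ + gam μ β ^ 2 / 2 * (‖θ₀‖ ^ 2 / gradNorm μ β ψ θ₀))⁻¹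

end

end WeakToStrong

/-! The argument follows gradient descent on the population loss over the short time `τ`, shows that
it raises the cosine with `θs`, and then compares SGD with it.

Rate at time zero. The derivative of the cosine along `-∇L(θ₀)` pairs the gradient with `Σ` applied
to the part of `θs` orthogonal to `θ₀`. That part equals `(1 - c²) θs - c p`, where `c` is the
cosine and `p` the part of the unit student orthogonal to `θs`; the two terms give the learning and
unlearning potentials. Ellipticity evaluates the expectations: a function of `vᵀx` correlates with
`wᵀx` only through the component of `w` along `v`, up to `ε‖w‖_Σ`. Hence the rate is at least `βρ /
‖θ₀‖_Σ` (`IsElliptical.rho_le`).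

Gain of gradient descent. The loss is `K`-smooth with `K = λmax β²/4`. The logarithmic branch of `τ`
keeps every iterate at norm at least `γ‖θ₀‖` and every gradient at norm at most `D = G + γ‖θ₀‖`
(`norm_gd_ge`). There the cosine has a quadratic lower bound (`cos_sub_cos_ge`), and the other
branch of `τ` keeps the second order loss below two thirds of the linear gain `2α_*`
(`IsElliptical.gd_gain`).

SGD. The minibatch gradient is unbiased given the past, so the mean squared distance to gradient
descent satisfies a linear recursion (`lintegral_sgd_sub_gd_le`). By Chebyshev the distance is below
`δ` with the claimed probability, and `δ` is the radius within which the cosine moves by at most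
`α_*/4`. What remains is at least `2/3 - 1/4 > 1/4` of `α_*`. -/

namespace WeakToStrong

/-! ### Spectral bounds for a symmetric matrix -/

variable {d : ℕ} {M : Matrix (Fin d) (Fin d) ℝ}

lemma app_sub (M : Matrix (Fin d) (Fin d) ℝ) (u v : Vec d) : app M (u - v) = app M u - app M v :=
  map_sub _ _ _

lemma app_smul (M : Matrix (Fin d) (Fin d) ℝ) (a : ℝ) (v : Vec d) : app M (a • v) = a • app M v :=
  map_smul _ _ _

lemma inner_app_left (hM : M.IsHermitian) (u v : Vec d) : ⟪app M u, v⟫ = ⟪u, app M v⟫ :=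
  Matrix.isSymmetric_toEuclideanLin_iff.mpr hM u v

lemma inner_app_self_eq_sum (hM : M.IsHermitian) (u : Vec d) :
    innerM M u u = ∑ i, hM.eigenvalues i * ⟪hM.eigenvectorBasis i, u⟫ ^ 2 := by
  unfold innerM
  rw [← hM.eigenvectorBasis.sum_inner_mul_inner]
  refine Finset.sum_congr rfl fun i _ => ?_
  have h : app M (hM.eigenvectorBasis i) = hM.eigenvalues i • hM.eigenvectorBasis i := by
    have := hM.mulVec_eigenvectorBasis i
    ext j
    simpa [app] using congrFun this j
  rw [← inner_app_left hM, h, real_inner_smul_left, real_inner_comm]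
  ring

lemma norm_sq_eq_sum (hM : M.IsHermitian) (u : Vec d) :
    ‖u‖ ^ 2 = ∑ i, ⟪hM.eigenvectorBasis i, u⟫ ^ 2 := by
  rw [← real_inner_self_eq_norm_sq, ← hM.eigenvectorBasis.sum_inner_mul_inner]
  refine Finset.sum_congr rfl fun i _ => ?_
  rw [real_inner_comm]
  ring

lemma eigenvalues_le_lamMax (hM : M.IsHermitian) (i : Fin d) : hM.eigenvalues i ≤ lamMax M := by
  unfold lamMax
  rw [hM.spectrum_real_eq_range_eigenvalues]
  exact le_csSup (Set.finite_range _).bddAbove ⟨i, rfl⟩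

lemma lamMin_le_eigenvalues (hM : M.IsHermitian) (i : Fin d) : lamMin M ≤ hM.eigenvalues i := by
  unfold lamMin
  rw [hM.spectrum_real_eq_range_eigenvalues]
  exact csInf_le (Set.finite_range _).bddBelow ⟨i, rfl⟩

lemma innerM_self_le (hM : M.IsHermitian) (u : Vec d) : innerM M u u ≤ lamMax M * ‖u‖ ^ 2 := by
  rw [inner_app_self_eq_sum hM, norm_sq_eq_sum hM, Finset.mul_sum]
  exact Finset.sum_le_sum fun i _ =>
    mul_le_mul_of_nonneg_right (eigenvalues_le_lamMax hM i) (sq_nonneg _)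

lemma le_innerM_self (hM : M.IsHermitian) (u : Vec d) : lamMin M * ‖u‖ ^ 2 ≤ innerM M u u := by
  rw [inner_app_self_eq_sum hM, norm_sq_eq_sum hM, Finset.mul_sum]
  exact Finset.sum_le_sum fun i _ =>
    mul_le_mul_of_nonneg_right (lamMin_le_eigenvalues hM i) (sq_nonneg _)

lemma lamMin_pos [Nonempty (Fin d)] (hM : M.PosDef) : 0 < lamMin M := by
  unfold lamMin
  rw [hM.1.spectrum_real_eq_range_eigenvalues]
  obtain ⟨i, hi⟩ := (Set.range_nonempty hM.1.eigenvalues).csInf_mem (Set.finite_range _)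
  rw [← hi]
  exact hM.eigenvalues_pos i

lemma lamMin_le_lamMax [Nonempty (Fin d)] (hM : M.IsHermitian) : lamMin M ≤ lamMax M :=
  (lamMin_le_eigenvalues hM (Classical.arbitrary _)).trans (eigenvalues_le_lamMax hM _)

lemma lamMax_pos [Nonempty (Fin d)] (hM : M.PosDef) : 0 < lamMax M :=
  (lamMin_pos hM).trans_le (lamMin_le_lamMax hM.1)

open scoped MatrixOrder Matrix.Norms.L2Operator in
/-- A positive definite matrix factors as `AᵀA`. -/
lemma exists_innerM_eq_inner (hM : M.PosDef) :
    ∃ A : Vec d →ₗ[ℝ] Vec d, ∀ u v, innerM M u v = ⟪A u, A v⟫ := by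
  obtain ⟨B, rfl⟩ := CStarAlgebra.nonneg_iff_eq_star_mul_self.mp hM.posSemidef.nonneg
  refine ⟨Matrix.toEuclideanLin B, fun u v => ?_⟩
  unfold innerM app
  rw [← LinearMap.adjoint_inner_right, ← Matrix.toEuclideanLin_conjTranspose_eq_adjoint]
  congr 1
  ext j
  simp [Matrix.mulVec_mulVec, Matrix.star_eq_conjTranspose]

/-! ### The cosine in an inner product space: expansion and Lipschitz bound -/

section Cos

variable {E : Type*} [NormedAddCommGroup E] [InnerProductSpace ℝ E]

/-- Paired with `s` and divided by `‖a‖`, this vector is the exact error of linearizing `⟪s, z⟫ /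
‖z‖` at `a`. Its length depends only on the angular defect `y = ‖a‖‖z‖ - ⟪a, z⟫` and the radial
defect `W = (‖z‖ - ‖a‖)²`, which satisfy `‖z - a‖² = W + 2y`. -/
lemma norm_sq_cos_remainder (a z : E) (ha : a ≠ 0) (hz : z ≠ 0) :
    ‖((⟪a, z⟫ / ‖a‖ - ‖a‖) / ‖a‖) • a - ((‖z‖ - ‖a‖) / ‖z‖) • z‖ ^ 2 =
      ((‖a‖ * ‖z‖ - ⟪a, z⟫) / ‖z‖) ^ 2 +
        (‖a‖ * ‖z‖ - ⟪a, z⟫) / (‖a‖ * ‖z‖) * (2 - (‖a‖ * ‖z‖ - ⟪a, z⟫) / (‖a‖ * ‖z‖)) *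
          (‖z‖ - ‖a‖) ^ 2 := by
  have ha' : ‖a‖ ≠ 0 := norm_ne_zero_iff.mpr ha
  have hz' : ‖z‖ ≠ 0 := norm_ne_zero_iff.mpr hz
  rw [norm_sub_sq_real, norm_smul, norm_smul, real_inner_smul_left, real_inner_smul_right,
    mul_pow, mul_pow, Real.norm_eq_abs, Real.norm_eq_abs, sq_abs, sq_abs]
  field_simp
  ring

/-- A second order lower bound for the cosine with `s`, as a function of the other argument. -/
lemma cos_sub_cos_ge (s a z : E) (m : ℝ) (hs : ‖s‖ ≤ 1) (hm : 0 < m) (hma : m ≤ ‖a‖)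
    (hmz : m ≤ ‖z‖) :
    ⟪s - (⟪s, a⟫ / ‖a‖ ^ 2) • a, z - a⟫ / ‖a‖ - 3 / 4 * ‖z - a‖ ^ 2 / m ^ 2 ≤
      ⟪s, z⟫ / ‖z‖ - ⟪s, a⟫ / ‖a‖ := by
  have hp : 0 < ‖a‖ := hm.trans_le hma
  have hr : 0 < ‖z‖ := hm.trans_le hmz
  have ha : a ≠ 0 := norm_pos_iff.mp hp
  have hz : z ≠ 0 := norm_pos_iff.mp hr
  -- An exact remainder replaces Taylor's formula along the segment, so only the two endpoints need
  -- to stay away from the origin.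
  set v := ((⟪a, z⟫ / ‖a‖ - ‖a‖) / ‖a‖) • a - ((‖z‖ - ‖a‖) / ‖z‖) • z with hv
  have key : ⟪s, z⟫ / ‖z‖ - ⟪s, a⟫ / ‖a‖ -
      ⟪s - (⟪s, a⟫ / ‖a‖ ^ 2) • a, z - a⟫ / ‖a‖ = ⟪s, v⟫ / ‖a‖ := by
    simp only [hv, inner_sub_right, inner_smul_right, inner_sub_left, inner_smul_left,
      real_inner_self_eq_norm_sq, conj_trivial]
    field_simp
    ring
  have hh : ‖z - a‖ ^ 2 = (‖z‖ - ‖a‖) ^ 2 + 2 * (‖a‖ * ‖z‖ - ⟪a, z⟫) := by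
    rw [norm_sub_sq_real, real_inner_comm]; ring
  have hy : 0 ≤ ‖a‖ * ‖z‖ - ⟪a, z⟫ := sub_nonneg.mpr (real_inner_le_norm a z)
  have hv2 := norm_sq_cos_remainder a z ha hz
  rw [← hv] at hv2
  set y := ‖a‖ * ‖z‖ - ⟪a, z⟫
  set W := (‖z‖ - ‖a‖) ^ 2 with hW
  have hW0 : 0 ≤ W := sq_nonneg _
  set p := ‖a‖
  set r := ‖z‖
  have h1 : (y / r) ^ 2 ≤ (p / m ^ 2) ^ 2 * y ^ 2 := by
    rw [div_eq_mul_inv, mul_pow, mul_comm]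
    refine mul_le_mul_of_nonneg_right ?_ (sq_nonneg _)
    refine pow_le_pow_left₀ (by positivity) ?_ 2
    rw [inv_eq_one_div, div_le_div_iff₀ hr (by positivity)]
    nlinarith [mul_le_mul hma hmz hm.le hp.le]
  have h2 : y / (p * r) * (2 - y / (p * r)) * W ≤ 2 * (p / m ^ 2) ^ 2 * (y * W) := by
    have : y / (p * r) ≤ (p / m ^ 2) ^ 2 * y := by
      rw [div_eq_mul_inv, mul_comm]
      refine mul_le_mul_of_nonneg_right ?_ hy
      rw [inv_eq_one_div, div_pow, div_le_div_iff₀ (by positivity) (by positivity)]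
      calc 1 * (m ^ 2) ^ 2 = (m * m) * (m * m) := by ring
        _ ≤ (p * p) * (p * r) := by gcongr
        _ = _ := by ring
    have h0 : 0 ≤ y / (p * r) := by positivity
    have h3 : y / (p * r) * (2 - y / (p * r)) ≤ 2 * (y / (p * r)) := by nlinarith
    nlinarith [mul_le_mul_of_nonneg_right h3 hW0, mul_le_mul_of_nonneg_right this hW0]
  -- So far `‖v‖² ≤ (p/m²)² (y² + 2yW)`, and `y² + 2yW ≤ (9/16)(W + 2y)²`; this is the origin of
  -- `3/4`.
  have h3 : ‖v‖ ≤ 3 / 4 * (p / m ^ 2) * (W + 2 * y) := by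
    refine le_of_sq_le_sq ?_ (by positivity)
    rw [hv2]
    have : (0:ℝ) ≤ (p / m ^ 2) ^ 2 := sq_nonneg _
    nlinarith [mul_nonneg this (mul_nonneg hy hW0), mul_nonneg this (sq_nonneg y),
      mul_nonneg this (sq_nonneg W)]
  have h4 : -‖v‖ ≤ ⟪s, v⟫ := by
    have := abs_real_inner_le_norm s v
    have h5 : ‖s‖ * ‖v‖ ≤ ‖v‖ := mul_le_of_le_one_left (norm_nonneg _) hs
    linarith [neg_abs_le ⟪s, v⟫]
  have h5 : -(3 / 4 * (W + 2 * y) / m ^ 2) ≤ ⟪s, v⟫ / p := by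
    rw [le_div_iff₀ hp]
    have : 3 / 4 * (W + 2 * y) / m ^ 2 * p = 3 / 4 * (p / m ^ 2) * (W + 2 * y) := by ring
    linarith
  rw [hh]
  linarith

/-- The cosine is Lipschitz away from the origin. -/
lemma abs_cos_sub_cos_le (s w z : E) (hs : ‖s‖ ≤ 1) (hz : z ≠ 0) :
    |⟪s, w⟫ / ‖w‖ - ⟪s, z⟫ / ‖z‖| ≤ 2 * ‖w - z‖ / ‖z‖ := by
  have hr : 0 < ‖z‖ := norm_pos_iff.mpr hz
  have h1 : ⟪s, w⟫ / ‖w‖ - ⟪s, z⟫ / ‖z‖ = ⟪s, w - z⟫ / ‖z‖ + ⟪s, w⟫ / ‖w‖ * ((‖z‖ - ‖w‖) / ‖z‖) := by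
    rw [inner_sub_right]
    rcases eq_or_ne w 0 with rfl | hw
    · simp [neg_div]
    · have : ‖w‖ ≠ 0 := norm_ne_zero_iff.mpr hw
      field_simp
      ring
  have h2 : |⟪s, w - z⟫| ≤ ‖w - z‖ :=
    (abs_real_inner_le_norm _ _).trans (mul_le_of_le_one_left (norm_nonneg _) hs)
  have h3 : |⟪s, w⟫ / ‖w‖| ≤ 1 := by
    rw [abs_div, abs_norm]
    refine div_le_one_of_le₀ ?_ (norm_nonneg _)
    exact (abs_real_inner_le_norm _ _).trans (mul_le_of_le_one_left (norm_nonneg _) hs)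
  have h4 : |‖z‖ - ‖w‖| ≤ ‖w - z‖ := by rw [abs_sub_comm]; exact abs_norm_sub_norm_le w z
  rw [h1]
  refine (abs_add_le _ _).trans ?_
  rw [abs_mul, mul_div_assoc, two_mul, abs_div _ ‖z‖, abs_div _ ‖z‖, abs_norm]
  refine add_le_add (by gcongr) ?_
  calc |⟪s, w⟫ / ‖w‖| * (|‖z‖ - ‖w‖| / ‖z‖) ≤ 1 * (‖w - z‖ / ‖z‖) := by gcongr
    _ = _ := one_mul _

end Cos

/-! ### The norm of a positive definite matrix and its comparison with the Euclidean norm -/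

section MatrixNorm

lemma innerM_comm (hM : M.IsHermitian) (u v : Vec d) : innerM M u v = innerM M v u := by
  unfold innerM
  rw [← inner_app_left hM, real_inner_comm]

lemma innerM_self_nonneg (hM : M.PosDef) (u : Vec d) : 0 ≤ innerM M u u := by
  obtain ⟨A, hA⟩ := exists_innerM_eq_inner hM
  rw [hA]
  exact real_inner_self_nonneg

lemma normM_nonneg (M : Matrix (Fin d) (Fin d) ℝ) (u : Vec d) : 0 ≤ normM M u := Real.sqrt_nonneg _

lemma normM_sq (hM : M.PosDef) (u : Vec d) : normM M u ^ 2 = innerM M u u :=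
  Real.sq_sqrt (innerM_self_nonneg hM u)

lemma normM_eq_norm {A : Vec d →ₗ[ℝ] Vec d} (hA : ∀ u v, innerM M u v = ⟪A u, A v⟫) (u : Vec d) :
    normM M u = ‖A u‖ := by
  unfold normM
  rw [hA, real_inner_self_eq_norm_sq, Real.sqrt_sq (norm_nonneg _)]

lemma abs_innerM_le (hM : M.PosDef) (u v : Vec d) : |innerM M u v| ≤ normM M u * normM M v := by
  obtain ⟨A, hA⟩ := exists_innerM_eq_inner hM
  rw [hA, normM_eq_norm hA, normM_eq_norm hA]
  exact abs_real_inner_le_norm _ _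

lemma innerM_smul_left (M : Matrix (Fin d) (Fin d) ℝ) (a : ℝ) (u v : Vec d) :
    innerM M (a • u) v = a * innerM M u v := real_inner_smul_left _ _ _

lemma innerM_smul_right (M : Matrix (Fin d) (Fin d) ℝ) (a : ℝ) (u v : Vec d) :
    innerM M u (a • v) = a * innerM M u v := by
  unfold innerM
  rw [app_smul, real_inner_smul_right]

lemma innerM_sub_left (M : Matrix (Fin d) (Fin d) ℝ) (u v w : Vec d) :
    innerM M (u - v) w = innerM M u w - innerM M v w := inner_sub_left _ _ _

lemma innerM_sub_right (M : Matrix (Fin d) (Fin d) ℝ) (u v w : Vec d) :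
    innerM M u (v - w) = innerM M u v - innerM M u w := by
  unfold innerM
  rw [app_sub, inner_sub_right]

lemma normM_smul (hM : M.PosDef) (a : ℝ) (u : Vec d) : normM M (a • u) = |a| * normM M u := by
  obtain ⟨A, hA⟩ := exists_innerM_eq_inner hM
  rw [normM_eq_norm hA, normM_eq_norm hA, map_smul, norm_smul, Real.norm_eq_abs]

lemma normM_le (hM : M.PosDef) (u : Vec d) : normM M u ≤ √(lamMax M) * ‖u‖ := by
  unfold normM
  refine (Real.sqrt_le_sqrt (innerM_self_le hM.1 u)).trans ?_
  rw [Real.sqrt_mul' _ (sq_nonneg _), Real.sqrt_sq (norm_nonneg _)]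

lemma le_normM (hM : M.PosDef) (u : Vec d) : √(lamMin M) * ‖u‖ ≤ normM M u := by
  unfold normM
  refine le_trans ?_ (Real.sqrt_le_sqrt (le_innerM_self hM.1 u))
  rw [Real.sqrt_mul' _ (sq_nonneg _), Real.sqrt_sq (norm_nonneg _)]

lemma normM_pos [Nonempty (Fin d)] (hM : M.PosDef) {u : Vec d} (hu : u ≠ 0) : 0 < normM M u :=
  lt_of_lt_of_le (mul_pos (Real.sqrt_pos.mpr (lamMin_pos hM)) (norm_pos_iff.mpr hu)) (le_normM hM u)

/-- Cauchy–Schwarz for `⟨·,·⟩_M` applied to `‖Mu‖² = ⟨Mu, u⟩_M`, followed by cancelling one factor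
`‖Mu‖`. -/
lemma norm_app_le (hM : M.PosDef) (u : Vec d) : ‖app M u‖ ≤ √(lamMax M) * normM M u := by
  have h1 : ‖app M u‖ ^ 2 = innerM M (app M u) u := (real_inner_self_eq_norm_sq _).symm
  have h2 := (le_abs_self _).trans (abs_innerM_le hM (app M u) u)
  rcases (norm_nonneg (app M u)).eq_or_lt' with h0 | h0
  · rw [h0]
    exact mul_nonneg (Real.sqrt_nonneg _) (normM_nonneg _ _)
  · have h3 := mul_le_mul_of_nonneg_right (normM_le hM (app M u)) (normM_nonneg M u)
    refine le_of_mul_le_mul_left ?_ h0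
    nlinarith

lemma normM_app_le (hM : M.PosDef) (hL : 0 ≤ lamMax M) (u : Vec d) :
    normM M (app M u) ≤ lamMax M * normM M u := by
  refine (normM_le hM _).trans ?_
  calc √(lamMax M) * ‖app M u‖ ≤ √(lamMax M) * (√(lamMax M) * normM M u) := by
        gcongr; exact norm_app_le hM u
    _ = _ := by rw [← mul_assoc, Real.mul_self_sqrt hL]

/-- Dual to `norm_app_le`: Euclidean Cauchy–Schwarz applied to `‖u‖_M² = ⟪u, Mu⟫`. -/
lemma le_norm_app (hM : M.PosDef) (u : Vec d) : √(lamMin M) * normM M u ≤ ‖app M u‖ := by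
  have h1 : normM M u ^ 2 ≤ ‖u‖ * ‖app M u‖ := by
    rw [normM_sq hM]
    exact real_inner_le_norm _ _
  have h2 := mul_le_mul_of_nonneg_right (le_normM hM u) (norm_nonneg (app M u))
  rcases (normM_nonneg M u).eq_or_lt' with h0 | h0
  · simp [h0]
  · refine le_of_mul_le_mul_left ?_ h0
    nlinarith [mul_le_mul_of_nonneg_left h1 (Real.sqrt_nonneg (lamMin M))]

lemma le_normM_app (hM : M.PosDef) (hL : 0 ≤ lamMin M) (u : Vec d) :
    lamMin M * normM M u ≤ normM M (app M u) := by
  refine le_trans ?_ (le_normM hM _)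
  calc lamMin M * normM M u = √(lamMin M) * (√(lamMin M) * normM M u) := by
        rw [← mul_assoc, Real.mul_self_sqrt hL]
    _ ≤ _ := by gcongr; exact le_norm_app hM u

lemma innerM_sq (hM : M.IsHermitian) (u v : Vec d) : innerM (M ^ 2) u v = innerM M (app M u) v := by
  have h : app (M ^ 2) v = app M (app M v) := by
    ext j
    simp [app, pow_two, Matrix.mulVec_mulVec]
  unfold innerM
  rw [h, inner_app_left hM]

lemma trace_le (hM : M.IsHermitian) : M.trace ≤ d * lamMax M := by
  have h : ∀ i, M i i ≤ lamMax M := fun i => by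
    have := innerM_self_le hM (EuclideanSpace.single i 1)
    simpa [innerM, app, EuclideanSpace.inner_single_left] using this
  calc M.trace = ∑ i, M i i := rfl
    _ ≤ ∑ _i : Fin d, lamMax M := Finset.sum_le_sum fun i _ => h i
    _ = _ := by simp

lemma cosM_comm (hM : M.IsHermitian) (u v : Vec d) : cosM M u v = cosM M v u := by
  unfold cosM
  rw [innerM_comm hM, mul_comm]

end MatrixNorm

end WeakToStrong

namespace WeakToStrong

variable {d : ℕ}

/-! ### The logistic loss of one sample and its gradient -/

section Loss

lemma sigmoid_eq (β s : ℝ) : sigmoid β s = Real.sigmoid (β * s) := by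
  rw [sigmoid, Real.sigmoid_def, one_div]

lemma sigmoid_nonneg (β s : ℝ) : 0 ≤ sigmoid β s := by
  rw [sigmoid_eq]; exact Real.sigmoid_nonneg _

lemma sigmoid_le_one (β s : ℝ) : sigmoid β s ≤ 1 := by
  rw [sigmoid_eq]; exact Real.sigmoid_le_one _

lemma continuous_sigmoid (β : ℝ) : Continuous (sigmoid β) := by
  have : sigmoid β = fun s => Real.sigmoid (β * s) := funext (sigmoid_eq β)
  rw [this]
  exact _root_.continuous_sigmoid.comp (continuous_const.mul continuous_id)

lemma hasDerivAt_sigmoid (β s : ℝ) :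
    HasDerivAt (sigmoid β) (β * (sigmoid β s * (1 - sigmoid β s))) s := by
  have : sigmoid β = fun s => Real.sigmoid (β * s) := funext (sigmoid_eq β)
  rw [this]
  have h := (Real.hasDerivAt_sigmoid (β * s)).comp s ((hasDerivAt_id s).const_mul β)
  refine h.congr_deriv ?_
  simp only [mul_one]
  ring

/-- The derivative is `βσ(1 - σ)`, and `σ(1 - σ) ≤ 1/4`. -/
lemma abs_sigmoid_sub_le {β : ℝ} (hβ : 0 < β) (s t : ℝ) :
    |sigmoid β s - sigmoid β t| ≤ β / 4 * |s - t| := by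
  have := (convex_univ (𝕜 := ℝ) (E := ℝ)).norm_image_sub_le_of_norm_hasDerivWithin_le
    (f := sigmoid β) (C := β / 4) (x := t) (y := s)
    (fun x _ => (hasDerivAt_sigmoid β x).hasDerivWithinAt) (fun x _ => ?_) trivial trivial
  · simpa [Real.norm_eq_abs] using this
  · have h0 := sigmoid_nonneg β x
    have h1 := sigmoid_le_one β x
    rw [Real.norm_eq_abs, abs_of_nonneg (mul_nonneg hβ.le (mul_nonneg h0 (by linarith)))]
    nlinarith [sq_nonneg (sigmoid β x - 1 / 2)]

/-- The teacher's label as a real number. -/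
noncomputable def labelR (ψ x : Vec d) : ℝ := if 0 ≤ ⟪ψ, x⟫ then 1 else 0

lemma labelR_nonneg (ψ x : Vec d) : 0 ≤ labelR ψ x := by
  unfold labelR; split_ifs <;> norm_num

lemma labelR_le_one (ψ x : Vec d) : labelR ψ x ≤ 1 := by
  unfold labelR; split_ifs <;> norm_num

lemma measurable_labelR (ψ : Vec d) : Measurable (labelR ψ) :=
  Measurable.ite (measurableSet_le measurable_const (by fun_prop)) measurable_const measurable_const

/-- The gradient of the loss of one sample. -/
noncomputable def sampleGrad (β : ℝ) (ψ θ x : Vec d) : Vec d :=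
  (β * (sigmoid β ⟪θ, x⟫ - labelR ψ x)) • x

lemma abs_residual_le (β : ℝ) (ψ θ x : Vec d) : |sigmoid β ⟪θ, x⟫ - labelR ψ x| ≤ 1 := by
  rw [abs_le]
  constructor <;> linarith [sigmoid_nonneg β ⟪θ, x⟫, sigmoid_le_one β ⟪θ, x⟫, labelR_nonneg ψ x,
    labelR_le_one ψ x]

lemma norm_sampleGrad_le {β : ℝ} (hβ : 0 < β) (ψ θ x : Vec d) :
    ‖sampleGrad β ψ θ x‖ ≤ β * ‖x‖ := by
  rw [sampleGrad, norm_smul, Real.norm_eq_abs, abs_mul, abs_of_pos hβ]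
  have := abs_residual_le β ψ θ x
  gcongr
  exact mul_le_of_le_one_right hβ.le this

lemma loss_eq (β : ℝ) (ψ θ x : Vec d) : loss β θ x (label ψ x) =
    -(labelR ψ x * Real.log (sigmoid β ⟪θ, x⟫) +
      (1 - labelR ψ x) * Real.log (1 - sigmoid β ⟪θ, x⟫)) := by
  unfold loss prob label labelR
  split_ifs <;> simp_all

lemma hasDerivAt_logistic (β l s : ℝ) :
    HasDerivAt (fun s => -(l * Real.log (sigmoid β s) + (1 - l) * Real.log (1 - sigmoid β s)))
      (β * (sigmoid β s - l)) s := by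
  have h0 : 0 < sigmoid β s := by rw [sigmoid_eq]; exact Real.sigmoid_pos _
  have h1 : 0 < 1 - sigmoid β s := by rw [sigmoid_eq]; linarith [Real.sigmoid_lt_one (β * s)]
  have h := hasDerivAt_sigmoid β s
  refine (((h.log h0.ne').const_mul l).add (((h.const_sub 1).log h1.ne').const_mul (1 - l))).neg
    |>.congr_deriv ?_
  field_simp
  ring

lemma hasGradientAt_loss (β : ℝ) (ψ θ x : Vec d) :
    HasGradientAt (fun θ' => loss β θ' x (label ψ x)) (sampleGrad β ψ θ x) θ := by
  rw [hasGradientAt_iff_hasFDerivAt]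
  have h1 : HasFDerivAt (fun θ' : Vec d => ⟪θ', x⟫) (innerSL ℝ x) θ := by
    have := (innerSL ℝ x).hasFDerivAt (x := θ)
    refine this.congr_of_eventuallyEq (Filter.Eventually.of_forall fun y => ?_)
    simp [real_inner_comm]
  have h2 := (hasDerivAt_logistic β (labelR ψ x) ⟪θ, x⟫).comp_hasFDerivAt θ h1
  have h3 : (fun θ' => loss β θ' x (label ψ x)) =
      (fun s => -(labelR ψ x * Real.log (sigmoid β s) +
        (1 - labelR ψ x) * Real.log (1 - sigmoid β s))) ∘ (fun θ' : Vec d => ⟪θ', x⟫) := by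
    funext θ'
    exact loss_eq β ψ θ' x
  rw [h3]
  refine h2.congr_fderiv ?_
  ext y
  simp [sampleGrad]

lemma batchGrad_eq {B : ℕ} (β : ℝ) (ψ : Vec d) (x : Fin B → Vec d) (θ : Vec d) :
    batchGrad β ψ x θ = (1 / (B : ℝ)) • ∑ i, sampleGrad β ψ θ (x i) := by
  unfold batchGrad
  congr 1
  exact Finset.sum_congr rfl fun i _ => (hasGradientAt_loss β ψ θ (x i)).gradient

lemma measurable_sampleGrad {α : Type*} [MeasurableSpace α] (β : ℝ) (ψ : Vec d)
    {w x : α → Vec d} (hw : Measurable w) (hx : Measurable x) :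
    Measurable fun a => sampleGrad β ψ (w a) (x a) := by
  unfold sampleGrad
  have h1 : Measurable fun a => sigmoid β ⟪w a, x a⟫ :=
    (continuous_sigmoid β).measurable.comp (hw.inner hx)
  have h2 : Measurable fun a => labelR ψ (x a) := (measurable_labelR ψ).comp hx
  exact (measurable_const.mul (h1.sub h2)).smul hx

lemma measurable_sampleGrad_right (β : ℝ) (ψ θ : Vec d) : Measurable (sampleGrad β ψ θ) :=
  measurable_sampleGrad β ψ measurable_const measurable_id

end Loss

/-! ### Second moments of the data -/

section Moments

variable {μ : Measure (Vec d)}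

lemma memLp_inner (h2 : MemLp id 2 μ) (u : Vec d) : MemLp (fun x => ⟪u, x⟫) 2 μ :=
  h2.const_inner u

lemma integrable_norm_sq (h2 : MemLp id 2 μ) : Integrable (fun x => ‖x‖ ^ 2) μ :=
  h2.integrable_norm_pow two_ne_zero

lemma integrable_abs_inner_mul_inner (h2 : MemLp id 2 μ) (u v : Vec d) :
    Integrable (fun x => |⟪u, x⟫| * |⟪v, x⟫|) μ :=
  MemLp.integrable_mul (memLp_inner h2 u).abs (memLp_inner h2 v).abs

variable [IsProbabilityMeasure μ]

lemma integrable_inner (h2 : MemLp id 2 μ) (u : Vec d) : Integrable (fun x => ⟪u, x⟫) μ :=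
  (memLp_inner h2 u).integrable one_le_two

lemma integral_inner_eq_zero (h2 : MemLp id 2 μ) (h0 : ∫ x, x ∂μ = 0) (u : Vec d) :
    ∫ x, ⟪u, x⟫ ∂μ = 0 := by
  have := integral_inner (𝕜 := ℝ) (μ := μ) (f := fun x : Vec d => x) (h2.integrable one_le_two) u
  rw [this, h0, inner_zero_right]

lemma integral_inner_mul_inner (h2 : MemLp id 2 μ) (h0 : ∫ x, x ∂μ = 0) (u v : Vec d) :
    ∫ x, ⟪u, x⟫ * ⟪v, x⟫ ∂μ = innerM (covMat μ) u v := by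
  have hc : ∀ i, MemLp (fun x : Vec d => x i) 2 μ := fun i => by
    have := memLp_inner h2 (EuclideanSpace.single i (1 : ℝ))
    simpa [EuclideanSpace.inner_single_left] using this
  have h1 : cov[fun x : Vec d => ⟪u, x⟫, fun x => ⟪v, x⟫; μ] = ∫ x, ⟪u, x⟫ * ⟪v, x⟫ ∂μ := by
    rw [covariance, integral_inner_eq_zero h2 h0, integral_inner_eq_zero h2 h0]
    simp
  have hs : ∀ w : Vec d, (fun x : Vec d => ⟪w, x⟫) = fun x => ∑ i, w i * x i := fun w => by
    funext x
    simp [PiLp.inner_apply, mul_comm]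
  rw [← h1, hs u, hs v, covariance_fun_sum_fun_sum (fun i => (hc i).const_mul _)
    (fun i => (hc i).const_mul _)]
  simp only [covariance_const_mul_left, covariance_const_mul_right]
  simp only [innerM, app, PiLp.inner_apply, Matrix.toLpLin_apply, Matrix.mulVec, dotProduct,
    covMat, Matrix.of_apply, RCLike.inner_apply, conj_trivial, Finset.sum_mul]
  refine Finset.sum_congr rfl fun i _ => Finset.sum_congr rfl fun j _ => ?_
  ring

lemma integral_inner_sq (h2 : MemLp id 2 μ) (h0 : ∫ x, x ∂μ = 0) (u : Vec d) :
    ∫ x, ⟪u, x⟫ ^ 2 ∂μ = innerM (covMat μ) u u := by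
  rw [← integral_inner_mul_inner h2 h0]
  simp [pow_two]

lemma integral_norm_sq (h2 : MemLp id 2 μ) (h0 : ∫ x, x ∂μ = 0) :
    ∫ x, ‖x‖ ^ 2 ∂μ = (covMat μ).trace := by
  have h1 : ∀ i : Fin d, ∫ x : Vec d, x i ^ 2 ∂μ = covMat μ i i := fun i => by
    have := integral_inner_sq h2 h0 (EuclideanSpace.single i (1 : ℝ))
    simpa [EuclideanSpace.inner_single_left, innerM, app] using this
  simp only [EuclideanSpace.norm_sq_eq, Real.norm_eq_abs, sq_abs]
  rw [integral_finsetSum]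
  · exact Finset.sum_congr rfl fun i _ => h1 i
  · intro i _
    have := (memLp_inner h2 (EuclideanSpace.single i (1 : ℝ))).integrable_sq
    simpa [EuclideanSpace.inner_single_left] using this

lemma integral_abs_inner_mul_inner_le (h2 : MemLp id 2 μ) (h0 : ∫ x, x ∂μ = 0)
    (hM : (covMat μ).PosDef) (u v : Vec d) :
    ∫ x, |⟪u, x⟫| * |⟪v, x⟫| ∂μ ≤ normM (covMat μ) u * normM (covMat μ) v := by
  rcases eq_or_ne u 0 with rfl | hu
  · simpa using mul_nonneg (normM_nonneg _ _) (normM_nonneg _ _)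
  rcases eq_or_ne v 0 with rfl | hv
  · simpa using mul_nonneg (normM_nonneg _ _) (normM_nonneg _ _)
  have hne : Nonempty (Fin d) := by
    by_contra h
    rw [not_nonempty_iff] at h
    exact hu (Subsingleton.elim _ _)
  set a := normM (covMat μ) u with ha
  set b := normM (covMat μ) v with hb
  have ha0 : 0 < a := normM_pos hM hu
  have hb0 : 0 < b := normM_pos hM hv
  have hiu := (memLp_inner h2 u).integrable_sq
  have hiv := (memLp_inner h2 v).integrable_sq
  -- Cauchy–Schwarz through the weighted inequality `st ≤ (b/2a)s² + (a/2b)t²`, with weights that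
  -- make both halves integrate to `ab/2`.
  calc ∫ x, |⟪u, x⟫| * |⟪v, x⟫| ∂μ
      ≤ ∫ x, (b / (2 * a) * ⟪u, x⟫ ^ 2 + a / (2 * b) * ⟪v, x⟫ ^ 2) ∂μ := by
        refine integral_mono (integrable_abs_inner_mul_inner h2 u v)
          ((hiu.const_mul _).add (hiv.const_mul _)) fun x => ?_
        simp only
        rw [← sq_abs ⟪u, x⟫, ← sq_abs ⟪v, x⟫]
        have : b / (2 * a) * |⟪u, x⟫| ^ 2 + a / (2 * b) * |⟪v, x⟫| ^ 2 - |⟪u, x⟫| * |⟪v, x⟫| =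
            (b * |⟪u, x⟫| - a * |⟪v, x⟫|) ^ 2 / (2 * a * b) := by
          field_simp
          ring
        have h3 : 0 ≤ (b * |⟪u, x⟫| - a * |⟪v, x⟫|) ^ 2 / (2 * a * b) := by positivity
        linarith
    _ = a * b := by
        rw [integral_add (hiu.const_mul _) (hiv.const_mul _), integral_const_mul,
          integral_const_mul, integral_inner_sq h2 h0, integral_inner_sq h2 h0, ← normM_sq hM,
          ← normM_sq hM, ← ha, ← hb]
        field_simp
        ring

end Moments

/-! ### The population loss: gradient, smoothness and gradient noise -/

section PopLoss

variable {μ : Measure (Vec d)}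

/-- The gradient of the population loss. -/
noncomputable def popGrad (μ : Measure (Vec d)) (β : ℝ) (ψ θ : Vec d) : Vec d :=
  ∫ x, sampleGrad β ψ θ x ∂μ

lemma memLp_sampleGrad (h2 : MemLp id 2 μ) {β : ℝ} (hβ : 0 < β) (ψ θ : Vec d) :
    MemLp (sampleGrad β ψ θ) 2 μ := by
  refine (h2.norm.const_mul β).of_le (measurable_sampleGrad_right β ψ θ).aestronglyMeasurable
    (Filter.Eventually.of_forall fun x => ?_)
  rw [Real.norm_eq_abs]
  exact (norm_sampleGrad_le hβ ψ θ x).trans (le_abs_self _)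

variable [IsProbabilityMeasure μ]

lemma integrable_sampleGrad (h2 : MemLp id 2 μ) {β : ℝ} (hβ : 0 < β) (ψ θ : Vec d) :
    Integrable (sampleGrad β ψ θ) μ :=
  (memLp_sampleGrad h2 hβ ψ θ).integrable one_le_two

lemma inner_popGrad (h2 : MemLp id 2 μ) {β : ℝ} (hβ : 0 < β) (ψ θ w : Vec d) :
    ⟪w, popGrad μ β ψ θ⟫ = ∫ x, β * (sigmoid β ⟪θ, x⟫ - labelR ψ x) * ⟪w, x⟫ ∂μ := by
  rw [popGrad, ← integral_inner (𝕜 := ℝ) (integrable_sampleGrad h2 hβ ψ θ) w]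
  simp only [sampleGrad, real_inner_smul_right]

lemma measurable_loss (β : ℝ) (ψ θ : Vec d) : Measurable (fun x => loss β θ x (label ψ x)) := by
  have h1 : Measurable (fun x : Vec d => sigmoid β ⟪θ, x⟫) :=
    (continuous_sigmoid β).measurable.comp (by fun_prop)
  simp only [loss_eq]
  have h2 := measurable_labelR ψ
  fun_prop

lemma loss_zero (β : ℝ) (ψ x : Vec d) : loss β 0 x (label ψ x) = Real.log 2 := by
  rw [loss_eq]
  have : sigmoid β ⟪(0 : Vec d), x⟫ = 2⁻¹ := by
    rw [inner_zero_left, sigmoid_eq, mul_zero, Real.sigmoid_zero]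
  rw [this, show (1 : ℝ) - 2⁻¹ = 2⁻¹ by norm_num, Real.log_inv]
  ring

lemma abs_loss_sub_le {β : ℝ} (hβ : 0 < β) (ψ θ θ' x : Vec d) :
    |loss β θ x (label ψ x) - loss β θ' x (label ψ x)| ≤ β * ‖x‖ * ‖θ - θ'‖ := by
  have := (convex_univ (𝕜 := ℝ) (E := Vec d)).norm_image_sub_le_of_norm_hasFDerivWithin_le
    (f := fun θ => loss β θ x (label ψ x)) (C := β * ‖x‖) (x := θ') (y := θ)
    (fun y _ => (hasGradientAt_loss β ψ y x).hasFDerivAt.hasFDerivWithinAt) (fun y _ => ?_)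
    trivial trivial
  · simpa [Real.norm_eq_abs] using this
  · simpa using norm_sampleGrad_le hβ ψ y x

lemma integrable_loss (h2 : MemLp id 2 μ) {β : ℝ} (hβ : 0 < β) (ψ θ : Vec d) :
    Integrable (fun x => loss β θ x (label ψ x)) μ := by
  have hn : Integrable (fun x : Vec d => ‖x‖) μ := (h2.integrable one_le_two).norm
  refine Integrable.mono' ((hn.const_mul (β * ‖θ‖)).add (integrable_const (Real.log 2)))
    (measurable_loss β ψ θ).aestronglyMeasurable (Filter.Eventually.of_forall fun x => ?_)
  -- Comparison with `θ = 0`, where the loss is the constant `log 2`, gives a dominating function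
  -- affine in `‖x‖`.
  have h := abs_loss_sub_le hβ ψ θ 0 x
  rw [loss_zero, sub_zero] at h
  have h3 : 0 ≤ Real.log 2 := Real.log_nonneg one_le_two
  rw [Real.norm_eq_abs]
  calc |loss β θ x (label ψ x)| = |(loss β θ x (label ψ x) - Real.log 2) + Real.log 2| := by ring_nf
    _ ≤ β * ‖x‖ * ‖θ‖ + |Real.log 2| := (abs_add_le _ _).trans (by gcongr)
    _ = _ := by rw [abs_of_nonneg h3]; simp only [Pi.add_apply]; ring

lemma hasGradientAt_popLoss (h2 : MemLp id 2 μ) {β : ℝ} (hβ : 0 < β) (ψ θ : Vec d) :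
    HasGradientAt (popLoss μ β ψ) (popGrad μ β ψ θ) θ := by
  rw [hasGradientAt_iff_hasFDerivAt]
  have hn : Integrable (fun x : Vec d => ‖x‖) μ := (h2.integrable one_le_two).norm
  have h := hasFDerivAt_integral_of_dominated_of_fderiv_le (𝕜 := ℝ) (μ := μ)
    (F := fun θ x => loss β θ x (label ψ x))
    (F' := fun θ x => InnerProductSpace.toDual ℝ (Vec d) (sampleGrad β ψ θ x))
    (bound := fun x => β * ‖x‖) (x₀ := θ) (s := Set.univ) Filter.univ_mem
    (Filter.Eventually.of_forall fun y => (measurable_loss β ψ y).aestronglyMeasurable)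
    (integrable_loss h2 hβ ψ θ)
    ((InnerProductSpace.toDual ℝ (Vec d)).continuous.comp_aestronglyMeasurable
      (measurable_sampleGrad_right β ψ θ).aestronglyMeasurable)
    (Filter.Eventually.of_forall fun x y _ => by
      rw [LinearIsometryEquiv.norm_map]; exact norm_sampleGrad_le hβ ψ y x)
    (hn.const_mul β)
    (Filter.Eventually.of_forall fun x y _ => (hasGradientAt_loss β ψ y x).hasFDerivAt)
  refine h.congr_fderiv ?_
  exact ContinuousLinearMap.integral_comp_comm
    (InnerProductSpace.toDual ℝ (Vec d)).toContinuousLinearEquiv.toContinuousLinearMap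
    (integrable_sampleGrad h2 hβ ψ θ)

lemma gradNorm_eq (h2 : MemLp id 2 μ) {β : ℝ} (hβ : 0 < β) (ψ θ : Vec d) :
    gradNorm μ β ψ θ = ‖popGrad μ β ψ θ‖ := by
  rw [gradNorm, (hasGradientAt_popLoss h2 hβ ψ θ).gradient]

/-- The population loss is `λmax β² / 4`-smooth. -/
lemma norm_popGrad_sub_le (h2 : MemLp id 2 μ) (h0 : ∫ x, x ∂μ = 0) (hM : (covMat μ).PosDef)
    (hL : 0 ≤ lamMax (covMat μ)) {β : ℝ} (hβ : 0 < β) (ψ θ θ' : Vec d) :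
    ‖popGrad μ β ψ θ - popGrad μ β ψ θ'‖ ≤ lamMax (covMat μ) * β ^ 2 / 4 * ‖θ - θ'‖ := by
  set w := popGrad μ β ψ θ - popGrad μ β ψ θ' with hw
  have hi : ∀ θ, Integrable (fun x => β * (sigmoid β ⟪θ, x⟫ - labelR ψ x) * ⟪w, x⟫) μ := fun θ => by
    have := (integrable_sampleGrad h2 hβ ψ θ).const_inner (𝕜 := ℝ) w
    simpa only [sampleGrad, real_inner_smul_right] using this
  -- Pairing the gradient difference with itself cancels the label, so no regularity of the label is
  -- needed.
  have h1 : ‖w‖ ^ 2 ≤ ∫ x, β ^ 2 / 4 * (|⟪θ - θ', x⟫| * |⟪w, x⟫|) ∂μ := by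
    rw [← real_inner_self_eq_norm_sq]
    conv_lhs => rw [hw, inner_sub_right, ← hw]
    rw [inner_popGrad h2 hβ, inner_popGrad h2 hβ, ← integral_sub (hi θ) (hi θ')]
    refine integral_mono ((hi θ).sub (hi θ'))
      ((integrable_abs_inner_mul_inner h2 _ _).const_mul _) fun x => ?_
    simp only
    have h3 := abs_sigmoid_sub_le hβ ⟪θ, x⟫ ⟪θ', x⟫
    rw [← inner_sub_left] at h3
    calc β * (sigmoid β ⟪θ, x⟫ - labelR ψ x) * ⟪w, x⟫ -
          β * (sigmoid β ⟪θ', x⟫ - labelR ψ x) * ⟪w, x⟫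
        = β * ((sigmoid β ⟪θ, x⟫ - sigmoid β ⟪θ', x⟫) * ⟪w, x⟫) := by ring
      _ ≤ β * (|sigmoid β ⟪θ, x⟫ - sigmoid β ⟪θ', x⟫| * |⟪w, x⟫|) := by
          rw [← abs_mul]; gcongr; exact le_abs_self _
      _ ≤ β * (β / 4 * |⟪θ - θ', x⟫| * |⟪w, x⟫|) := by gcongr
      _ = _ := by ring
  rw [integral_const_mul] at h1
  have h4 := (integral_abs_inner_mul_inner_le h2 h0 hM (θ - θ') w)
  have h5 : normM (covMat μ) (θ - θ') * normM (covMat μ) w ≤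
      lamMax (covMat μ) * (‖θ - θ'‖ * ‖w‖) := by
    calc _ ≤ (√(lamMax (covMat μ)) * ‖θ - θ'‖) * (√(lamMax (covMat μ)) * ‖w‖) :=
          mul_le_mul (normM_le hM _) (normM_le hM _) (normM_nonneg _ _) (by positivity)
      _ = (√(lamMax (covMat μ)) * √(lamMax (covMat μ))) * (‖θ - θ'‖ * ‖w‖) := by ring
      _ = _ := by rw [Real.mul_self_sqrt hL]
  rcases (norm_nonneg w).eq_or_lt' with hz | hz
  · rw [hz]; positivity
  · refine le_of_mul_le_mul_right ?_ hz
    have h6 := mul_le_mul_of_nonneg_left (h4.trans h5) (by positivity : 0 ≤ β ^ 2 / 4)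
    nlinarith

lemma integral_norm_sampleGrad_sq_le (h2 : MemLp id 2 μ) (h0 : ∫ x, x ∂μ = 0)
    (hM : (covMat μ).PosDef) {β : ℝ} (hβ : 0 < β) (ψ θ : Vec d) :
    ∫ x, ‖sampleGrad β ψ θ x‖ ^ 2 ∂μ ≤ β ^ 2 * (d * lamMax (covMat μ)) := by
  calc ∫ x, ‖sampleGrad β ψ θ x‖ ^ 2 ∂μ ≤ ∫ x, β ^ 2 * ‖x‖ ^ 2 ∂μ := by
        refine integral_mono ((memLp_sampleGrad h2 hβ ψ θ).integrable_norm_pow two_ne_zero)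
          ((integrable_norm_sq h2).const_mul _) fun x => ?_
        simp only
        rw [← mul_pow]
        exact pow_le_pow_left₀ (norm_nonneg _) (norm_sampleGrad_le hβ ψ θ x) 2
    _ = β ^ 2 * (covMat μ).trace := by rw [integral_const_mul, integral_norm_sq h2 h0]
    _ ≤ _ := by gcongr; exact trace_le hM.1

end PopLoss

end WeakToStrong

namespace WeakToStrong

variable {d : ℕ}

/-! ### Orthogonal projection and the use of ellipticity -/

section Projection

variable {M : Matrix (Fin d) (Fin d) ℝ}

lemma innerM_projPerp_left (hM : M.PosDef) (w v : Vec d) (hw : innerM M w w ≠ 0) :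
    innerM M (projPerp M w v) w = 0 := by
  unfold projPerp
  rw [innerM_sub_left, innerM_smul_left, div_mul_cancel₀ _ hw, innerM_comm hM.1, sub_self]

lemma normM_projPerp_le (hM : M.PosDef) (w v : Vec d) : normM M (projPerp M w v) ≤ normM M v := by
  unfold normM
  refine Real.sqrt_le_sqrt ?_
  rcases (innerM_self_nonneg hM w).eq_or_lt' with h | h
  -- The quotient in `projPerp` is `0` here by division by zero, so nothing is removed.
  · simp [projPerp, h]
  · have h1 : innerM M (projPerp M w v) (projPerp M w v) =
        innerM M v v - innerM M w v ^ 2 / innerM M w w := by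
      conv_lhs => rw [projPerp, innerM_sub_right, innerM_smul_right, ← projPerp,
        innerM_projPerp_left hM _ _ h.ne', projPerp, innerM_sub_left, innerM_smul_left]
      ring
    rw [h1]
    have : 0 ≤ innerM M w v ^ 2 / innerM M w w := by positivity
    linarith

lemma ne_zero_of_normM_eq_one {u : Vec d} (hu : normM M u = 1) :
    u ≠ 0 := by
  rintro rfl
  simp [normM, innerM] at hu

end Projection

section Elliptical

variable {μ : Measure (Vec d)} [IsProbabilityMeasure μ] {ε : ℝ} {E : Submodule ℝ (Vec d)}

lemma integrable_comp_inner_mul (h2 : MemLp id 2 μ) {f : Vec d → ℝ} (hf : Measurable f)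
    (hb : ∀ x, |f x| ≤ 1) (u : Vec d) : Integrable (fun x => f x * ⟪u, x⟫) μ :=
  (integrable_inner h2 u).bdd_mul hf.aestronglyMeasurable (c := 1)
    (Filter.Eventually.of_forall hb)

/-- Conditioning on `vᵀx` pulls out the bounded factor `φ(vᵀx)` and leaves the conditional mean that
ellipticity controls. -/
lemma IsElliptical.abs_integral_le (h : IsElliptical μ ε E) {v u : Vec d} (hvE : v ∈ E)
    (hv : v ≠ 0) (huv : innerM (covMat μ) u v = 0) {φ : ℝ → ℝ} (hφ : Measurable φ)
    (hb : ∀ s, |φ s| ≤ 1) :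
    |∫ x, φ ⟪v, x⟫ * ⟪u, x⟫ ∂μ| ≤ ε * normM (covMat μ) u := by
  have hvm : Measurable (fun z : Vec d => ⟪v, z⟫) := by fun_prop
  have hint := integrable_comp_inner_mul h.memLp_two (hφ.comp hvm) (fun x => hb _) u
  have hle := hvm.comap_le
  set m := MeasurableSpace.comap (fun z : Vec d => ⟪v, z⟫) inferInstance with hm
  have hf : StronglyMeasurable[m] (fun x : Vec d => φ ⟪v, x⟫) :=
    (hφ.comp (comap_measurable _)).stronglyMeasurable
  have h1 := condExp_mul_of_stronglyMeasurable_left (μ := μ) hf hint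
    (integrable_inner h.memLp_two u)
  rw [← integral_condExp hle]
  have h2 : ∀ᵐ x ∂μ, ‖(μ[(fun x : Vec d => φ ⟪v, x⟫ * ⟪u, x⟫)|m]) x‖ ≤ ε * normM (covMat μ) u := by
    filter_upwards [h1, h.abs_condExp_le v hvE hv u huv] with x hx1 hx2
    have hx1' : (μ[(fun x : Vec d => φ ⟪v, x⟫ * ⟪u, x⟫)|m]) x =
      φ ⟪v, x⟫ * (μ[fun z : Vec d => ⟪u, z⟫|m]) x := hx1
    rw [hx1', Real.norm_eq_abs, abs_mul]
    calc _ ≤ 1 * (ε * normM (covMat μ) u) :=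
          mul_le_mul (hb _) hx2 (abs_nonneg _) zero_le_one
      _ = _ := one_mul _
  have := norm_integral_le_of_norm_le_const h2
  simpa using this

/-- Split `w` into its `Σ`-component along `v`, which gives the main term, and the orthogonal rest,
to which `IsElliptical.abs_integral_le` applies. -/
lemma IsElliptical.abs_integral_sub_le [Nonempty (Fin d)] (h : IsElliptical μ ε E) {v : Vec d}
    (hvE : v ∈ E) (hv : v ≠ 0) (w : Vec d) {φ : ℝ → ℝ} (hφ : Measurable φ)
    (hb : ∀ s, |φ s| ≤ 1) (hε : 0 ≤ ε) :
    |∫ x, φ ⟪v, x⟫ * ⟪w, x⟫ ∂μ -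
      innerM (covMat μ) w v / innerM (covMat μ) v v * ∫ x, φ ⟪v, x⟫ * ⟪v, x⟫ ∂μ| ≤
      ε * normM (covMat μ) w := by
  have hM := h.posDef
  have hvv : innerM (covMat μ) v v ≠ 0 := by
    rw [← normM_sq hM]
    exact (pow_pos (normM_pos hM hv) 2).ne'
  have h1 := h.abs_integral_le hvE hv (innerM_projPerp_left hM v w hvv) hφ hb
  have hfm : Measurable (fun x : Vec d => φ ⟪v, x⟫) := hφ.comp (by fun_prop)
  have hint := fun u => integrable_comp_inner_mul h.memLp_two hfm (fun x => hb _) u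
  have h2 : ∫ x, φ ⟪v, x⟫ * ⟪projPerp (covMat μ) v w, x⟫ ∂μ = ∫ x, φ ⟪v, x⟫ * ⟪w, x⟫ ∂μ -
      innerM (covMat μ) w v / innerM (covMat μ) v v * ∫ x, φ ⟪v, x⟫ * ⟪v, x⟫ ∂μ := by
    rw [← integral_const_mul, ← integral_sub (hint w) ((hint v).const_mul _)]
    refine integral_congr_ae (Filter.Eventually.of_forall fun x => ?_)
    simp only [projPerp, inner_sub_left, real_inner_smul_left]
    rw [innerM_comm hM.1 v w]
    ring
  rw [← h2]
  exact h1.trans (mul_le_mul_of_nonneg_left (normM_projPerp_le hM v w) hε)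

lemma integral_labelR_mul_inner (h2 : MemLp id 2 μ) (h0 : ∫ x, x ∂μ = 0) (ψ : Vec d) :
    ∫ x, labelR ψ x * ⟪ψ, x⟫ ∂μ = teacherScale μ ψ / 2 := by
  have h : ∀ x, labelR ψ x * ⟪ψ, x⟫ = (⟪ψ, x⟫ + |⟪ψ, x⟫|) / 2 := fun x => by
    unfold labelR
    split_ifs with hx
    · rw [abs_of_nonneg hx]; ring
    · rw [abs_of_neg (not_le.mp hx)]; ring
  simp only [h]
  rw [integral_div, integral_add (integrable_inner h2 ψ) (integrable_inner h2 ψ).abs,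
    integral_inner_eq_zero h2 h0, zero_add, teacherScale]

variable [Nonempty (Fin d)] {θs ψ θ₀ : Vec d} {β : ℝ}

lemma IsElliptical.abs_teacher_sub_le (h : IsElliptical μ ε E) (hε : 0 ≤ ε) (hψE : ψ ∈ E)
    (hψ : normM (covMat μ) ψ = 1) (w : Vec d) :
    |∫ x, labelR ψ x * ⟪w, x⟫ ∂μ - innerM (covMat μ) w ψ * (teacherScale μ ψ / 2)| ≤
      ε * normM (covMat μ) w := by
  have h1 := h.abs_integral_sub_le hψE (ne_zero_of_normM_eq_one hψ) w
    (φ := fun s => if 0 ≤ s then 1 else 0)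
    (Measurable.ite measurableSet_Ici measurable_const measurable_const)
    (fun s => by split_ifs <;> simp) hε
  rw [← normM_sq h.posDef ψ, hψ, one_pow, div_one] at h1
  rw [← integral_labelR_mul_inner h.memLp_two h.mean_zero]
  exact h1

lemma IsElliptical.abs_student_sub_le (h : IsElliptical μ ε E) (hε : 0 ≤ ε) (hθE : θ₀ ∈ E)
    (hθ : θ₀ ≠ 0) (w : Vec d) :
    |∫ x, sigmoid β ⟪θ₀, x⟫ * ⟪w, x⟫ ∂μ -
      conf μ β θ₀ * innerM (covMat μ) w (unitStudent μ θ₀)| ≤ ε * normM (covMat μ) w := by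
  have h1 := h.abs_integral_sub_le hθE hθ w (continuous_sigmoid β).measurable
    (fun s => abs_le.mpr ⟨by linarith [sigmoid_nonneg β s], sigmoid_le_one β s⟩) hε
  have hn := normM_pos h.posDef hθ
  rw [← normM_sq h.posDef θ₀] at h1
  rw [conf, unitStudent, innerM_smul_right]
  convert h1 using 3
  field_simp

/-- Teacher and student terms each cost `ε‖Σθs‖_Σ ≤ ελmax`, whence `2λmaxε`. The sign of `⟨θs,
ψ⟩_{Σ²}` is what allows `‖Σθs‖_Σ` to be replaced by its lower bound `λmin`. -/
lemma IsElliptical.rhoL_le (h : IsElliptical μ ε E) (hε : 0 ≤ ε) (hψE : ψ ∈ E) (hθE : θ₀ ∈ E)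
    (hs : normM (covMat μ) θs = 1) (hψ : normM (covMat μ) ψ = 1) (hθ : θ₀ ≠ 0)
    (hsψ : 0 ≤ innerM (covMat μ ^ 2) θs ψ) :
    rhoL μ β ε θs ψ θ₀ ≤ ∫ x, labelR ψ x * ⟪app (covMat μ) θs, x⟫ ∂μ -
      ∫ x, sigmoid β ⟪θ₀, x⟫ * ⟪app (covMat μ) θs, x⟫ ∂μ := by
  have hM := h.posDef
  have h1 := (abs_le.mp (h.abs_teacher_sub_le hε hψE hψ (app (covMat μ) θs))).1
  have h2 := (abs_le.mp (h.abs_student_sub_le (β := β) hε hθE hθ (app (covMat μ) θs))).2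
  have h3 := normM_app_le hM (lamMax_pos hM).le θs
  have h4 := le_normM_app hM (lamMin_pos hM).le θs
  rw [hs, mul_one] at h3 h4
  have h5 := mul_le_mul_of_nonneg_left h3 hε
  have hN : 0 < normM (covMat μ) (app (covMat μ) θs) := (lamMin_pos hM).trans_le h4
  rw [innerM_sq hM.1] at hsψ
  have h6 : lamMin (covMat μ) * cosM (covMat μ) (app (covMat μ) θs) ψ ≤
      innerM (covMat μ) (app (covMat μ) θs) ψ := by
    rw [cosM, hψ, mul_one, mul_div_assoc', div_le_iff₀ hN, mul_comm]
    exact mul_le_mul_of_nonneg_left h4 hsψ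
  have h7 : 0 ≤ teacherScale μ ψ := integral_nonneg fun x => abs_nonneg _
  have h8 := mul_le_mul_of_nonneg_right h6 h7
  unfold rhoL
  linarith

lemma IsElliptical.rhoU_le (h : IsElliptical μ ε E) (hε : 0 ≤ ε) (hψE : ψ ∈ E) (hθE : θ₀ ∈ E)
    (hψ : normM (covMat μ) ψ = 1) (hθ : θ₀ ≠ 0) :
    rhoU μ β ε θs ψ θ₀ ≤
      ∫ x, sigmoid β ⟪θ₀, x⟫ *
        ⟪app (covMat μ) (projPerp (covMat μ) θs (unitStudent μ θ₀)), x⟫ ∂μ -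
      ∫ x, labelR ψ x * ⟪app (covMat μ) (projPerp (covMat μ) θs (unitStudent μ θ₀)), x⟫ ∂μ := by
  have hM := h.posDef
  have hn := normM_pos hM hθ
  set p := projPerp (covMat μ) θs (unitStudent μ θ₀) with hp
  have h1 := (abs_le.mp (h.abs_teacher_sub_le hε hψE hψ (app (covMat μ) p))).2
  have h2 := (abs_le.mp (h.abs_student_sub_le (β := β) hε hθE hθ (app (covMat μ) p))).1
  have h3 : normM (covMat μ) (app (covMat μ) p) ≤ lamMax (covMat μ) := by
    refine (normM_app_le hM (lamMax_pos hM).le p).trans ?_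
    refine mul_le_of_le_one_right (lamMax_pos hM).le ((normM_projPerp_le hM _ _).trans ?_)
    rw [unitStudent, normM_smul hM, abs_of_pos (by positivity), one_div_mul_cancel hn.ne']
  have h5 := mul_le_mul_of_nonneg_left h3 hε
  have hp0 : projPerp (covMat μ) θs θ₀ = normM (covMat μ) θ₀ • p := by
    rw [hp, projPerp, projPerp, unitStudent, innerM_smul_right, smul_sub, smul_smul, smul_smul,
      mul_one_div_cancel hn.ne', one_smul]
    congr 2
    field_simp
  have h6 : innerM (covMat μ) (app (covMat μ) p) ψ ≤ lamMax (covMat μ) *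
      |cosM (covMat μ) (app (covMat μ) (projPerp (covMat μ) θs θ₀)) ψ| := by
    have hc : cosM (covMat μ) (app (covMat μ) (projPerp (covMat μ) θs θ₀)) ψ =
        innerM (covMat μ) (app (covMat μ) p) ψ / normM (covMat μ) (app (covMat μ) p) := by
      rw [hp0, cosM, app_smul, innerM_smul_left, normM_smul hM, abs_of_pos hn, hψ, mul_one,
        mul_div_mul_left _ _ hn.ne']
    have hle := abs_innerM_le hM (app (covMat μ) p) ψ
    rw [hψ, mul_one] at hle
    -- If `Σp` vanishes, the cosine takes its default value `0`, and Cauchy–Schwarz makes the inner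
    -- product vanish too.
    rcases (normM_nonneg (covMat μ) (app (covMat μ) p)).eq_or_lt' with hN | hN
    · rw [hN] at hle
      have : innerM (covMat μ) (app (covMat μ) p) ψ = 0 := abs_nonpos_iff.mp hle
      rw [this]
      exact mul_nonneg (lamMax_pos hM).le (abs_nonneg _)
    · rw [hc, abs_div, abs_of_pos hN, mul_div_assoc', le_div_iff₀ hN, mul_comm]
      exact (mul_le_mul_of_nonneg_left (le_abs_self _) hN.le).trans
        (mul_le_mul_of_nonneg_right h3 (abs_nonneg _))
  have h7 : 0 ≤ teacherScale μ ψ := integral_nonneg fun x => abs_nonneg _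
  have h8 := mul_le_mul_of_nonneg_right h6 h7
  unfold rhoU
  rw [← hp]
  linarith

/-- The signal bounds the initial rate of improvement of the cosine. -/
lemma IsElliptical.rho_le (h : IsElliptical μ ε E) (hε : 0 ≤ ε) (hβ : 0 < β) (hψE : ψ ∈ E)
    (hθE : θ₀ ∈ E) (hs : normM (covMat μ) θs = 1) (hψ : normM (covMat μ) ψ = 1) (hθ : θ₀ ≠ 0)
    (hsψ : 0 ≤ innerM (covMat μ ^ 2) θs ψ) (hsθ : 0 ≤ innerM (covMat μ) θs θ₀) :
    β * rho μ β ε θs ψ θ₀ ≤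
      -⟪app (covMat μ) (θs - (innerM (covMat μ) θs θ₀ / normM (covMat μ) θ₀ ^ 2) • θ₀),
        popGrad μ β ψ θ₀⟫ := by
  have hM := h.posDef
  have hn := normM_pos hM hθ
  set c := cosM (covMat μ) θs θ₀ with hc
  have hc' : c = innerM (covMat μ) θs θ₀ / normM (covMat μ) θ₀ := by rw [hc, cosM, hs, one_mul]
  have hc0 : 0 ≤ c := by rw [hc']; positivity
  have hc1 : c ^ 2 ≤ 1 := by
    rw [sq_le_one_iff_abs_le_one, hc', abs_div, abs_of_pos hn]
    refine div_le_one_of_le₀ ?_ hn.le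
    have := abs_innerM_le hM θs θ₀
    rwa [hs, one_mul] at this
  set p := projPerp (covMat μ) θs (unitStudent μ θ₀) with hp
  -- The gradient direction of the cosine splits into learning `θs` and unlearning `p`; the weights
  -- `1 - c²` and `c` are those in `rho`. Both are nonnegative, so the bounds on the two potentials
  -- add up.
  have hw : θs - (innerM (covMat μ) θs θ₀ / normM (covMat μ) θ₀ ^ 2) • θ₀ =
      (1 - c ^ 2) • θs - c • p := by
    rw [hp, projPerp, unitStudent, innerM_smul_right, ← normM_sq hM θs, hs, hc']
    simp only [one_pow, div_one, smul_sub, smul_smul, sub_smul, one_smul]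
    have e1 : innerM (covMat μ) θs θ₀ / normM (covMat μ) θ₀ * (1 / normM (covMat μ) θ₀) =
      innerM (covMat μ) θs θ₀ / normM (covMat μ) θ₀ ^ 2 := by field_simp
    have e2 : innerM (covMat μ) θs θ₀ / normM (covMat μ) θ₀ *
        (1 / normM (covMat μ) θ₀ * innerM (covMat μ) θs θ₀) =
      (innerM (covMat μ) θs θ₀ / normM (covMat μ) θ₀) ^ 2 := by field_simp
    rw [e1, e2]
    abel
  rw [hw, app_sub, app_smul, app_smul, inner_sub_left, real_inner_smul_left,
    real_inner_smul_left, inner_popGrad h.memLp_two hβ, inner_popGrad h.memLp_two hβ]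
  have hi : ∀ w, ∫ x, β * (sigmoid β ⟪θ₀, x⟫ - labelR ψ x) * ⟪w, x⟫ ∂μ =
      β * (∫ x, sigmoid β ⟪θ₀, x⟫ * ⟪w, x⟫ ∂μ - ∫ x, labelR ψ x * ⟪w, x⟫ ∂μ) := fun w => by
    have i1 : Integrable (fun x => sigmoid β ⟪θ₀, x⟫ * ⟪w, x⟫) μ :=
      integrable_comp_inner_mul h.memLp_two
        ((continuous_sigmoid β).measurable.comp (by fun_prop : Measurable fun x : Vec d => ⟪θ₀, x⟫))
        (fun x => abs_le.mpr ⟨by simp only [Function.comp]; linarith [sigmoid_nonneg β ⟪θ₀, x⟫],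
          sigmoid_le_one β _⟩) w
    have i2 : Integrable (fun x => labelR ψ x * ⟪w, x⟫) μ :=
      integrable_comp_inner_mul h.memLp_two (measurable_labelR ψ)
        (fun x => abs_le.mpr ⟨by linarith [labelR_nonneg ψ x], labelR_le_one ψ x⟩) w
    rw [← integral_sub i1 i2, ← integral_const_mul]
    congr 1
    funext x
    ring
  rw [hi, hi]
  have h1 := h.rhoL_le (β := β) hε hψE hθE hs hψ hθ hsψ
  have h2 := h.rhoU_le (θs := θs) (β := β) hε hψE hθE hψ hθ
  rw [← hp] at h2
  have h3 := mul_le_mul_of_nonneg_left h1 (by linarith : 0 ≤ 1 - c ^ 2)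
  have h4 := mul_le_mul_of_nonneg_left h2 hc0
  unfold rho
  rw [← hc]
  nlinarith [mul_le_mul_of_nonneg_left (add_le_add h3 h4) hβ.le]

end Elliptical

end WeakToStrong

namespace WeakToStrong

/-! ### Gradient descent along a Lipschitz field -/

section GradientDescent

variable {E : Type*} [NormedAddCommGroup E] [NormedSpace ℝ E]

/-- Gradient descent along the field `g`. -/
def gd (g : E → E) (η : ℝ) (θ₀ : E) : ℕ → E
  | 0 => θ₀
  | t + 1 => gd g η θ₀ t - η • g (gd g η θ₀ t)

variable {g : E → E} {η K D : ℝ} {θ₀ : E}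

/-- The quantity `‖g θ₀‖ + K‖θ_t - θ₀‖` dominates the current gradient, hence grows by a factor at
most `1 + ηK` per step. -/
lemma norm_gd_sub_le_geom (hη : 0 ≤ η) (hK : 0 < K) (hg : ∀ x y, ‖g x - g y‖ ≤ K * ‖x - y‖)
    (t : ℕ) : K * ‖gd g η θ₀ t - θ₀‖ ≤ ‖g θ₀‖ * ((1 + η * K) ^ t - 1) := by
  induction t with
  | zero => simp [gd]
  | succ t ih =>
    have h1 : ‖g (gd g η θ₀ t)‖ ≤ ‖g θ₀‖ + K * ‖gd g η θ₀ t - θ₀‖ := by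
      have := norm_add_le (g θ₀) (g (gd g η θ₀ t) - g θ₀)
      rw [add_sub_cancel] at this
      linarith [hg (gd g η θ₀ t) θ₀]
    have h2 : ‖gd g η θ₀ (t + 1) - θ₀‖ ≤ ‖gd g η θ₀ t - θ₀‖ + η * ‖g (gd g η θ₀ t)‖ := by
      rw [gd, sub_right_comm]
      refine (norm_sub_le _ _).trans ?_
      rw [norm_smul, Real.norm_of_nonneg hη]
    calc K * ‖gd g η θ₀ (t + 1) - θ₀‖
        ≤ K * (‖gd g η θ₀ t - θ₀‖ + η * (‖g θ₀‖ + K * ‖gd g η θ₀ t - θ₀‖)) := by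
          gcongr
          exact h2.trans (by gcongr)
      _ = (1 + η * K) * (K * ‖gd g η θ₀ t - θ₀‖) + η * K * ‖g θ₀‖ := by ring
      _ ≤ (1 + η * K) * (‖g θ₀‖ * ((1 + η * K) ^ t - 1)) + η * K * ‖g θ₀‖ := by gcongr
      _ = _ := by ring

lemma norm_gd_sub_le {T : ℕ} (hη : 0 ≤ η) (hD : ∀ t < T, ‖g (gd g η θ₀ t)‖ ≤ D) :
    ‖gd g η θ₀ T - θ₀‖ ≤ T * η * D := by
  induction T with
  | zero => simp [gd]
  | succ t ih =>
    have h1 := ih fun s hs => hD s (hs.trans t.lt_succ_self)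
    rw [gd, sub_right_comm]
    refine (norm_sub_le _ _).trans ?_
    rw [norm_smul, Real.norm_of_nonneg hη]
    have := mul_le_mul_of_nonneg_left (hD t t.lt_succ_self) hη
    push_cast
    linarith

/-- Freezing the field at `θ₀` costs at most `ηK · tηD` in step `t`; the sum over `t < T` is at most
`KD(Tη)²/2`. -/
lemma norm_gd_sub_add_le {T : ℕ} (hη : 0 ≤ η) (hK : 0 ≤ K) (hD0 : 0 ≤ D)
    (hg : ∀ x y, ‖g x - g y‖ ≤ K * ‖x - y‖) (hD : ∀ t < T, ‖g (gd g η θ₀ t)‖ ≤ D) :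
    ‖gd g η θ₀ T - θ₀ + (T * η) • g θ₀‖ ≤ K * D * (T * η) ^ 2 / 2 := by
  induction T with
  | zero => simp [gd]
  | succ t ih =>
    have h1 := ih fun s hs => hD s (hs.trans t.lt_succ_self)
    have h2 := norm_gd_sub_le hη fun s hs => hD s (hs.trans t.lt_succ_self)
    have h3 : gd g η θ₀ (t + 1) - θ₀ + (((t + 1 : ℕ) : ℝ) * η) • g θ₀ =
        (gd g η θ₀ t - θ₀ + (t * η) • g θ₀) - η • (g (gd g η θ₀ t) - g θ₀) := by
      rw [gd]
      push_cast
      module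
    rw [h3]
    refine (norm_sub_le _ _).trans ?_
    rw [norm_smul, Real.norm_of_nonneg hη]
    have h4 : η * ‖g (gd g η θ₀ t) - g θ₀‖ ≤ η * (K * (t * η * D)) := by
      gcongr
      exact (hg _ _).trans (by gcongr)
    have h5 : 0 ≤ K * D * η ^ 2 := by positivity
    push_cast
    nlinarith

end GradientDescent

/-! ### The cosine bounds transferred to `⟨·,·⟩_M` through a factor `A` -/

section CosineLinear

variable {d : ℕ} {M : Matrix (Fin d) (Fin d) ℝ}

lemma cosM_sub_cosM_ge (hM : M.PosDef) {s a z : Vec d} {m : ℝ} (hs : normM M s = 1) (hm : 0 < m)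
    (hma : m ≤ normM M a) (hmz : m ≤ normM M z) :
    ⟪app M (s - (innerM M s a / normM M a ^ 2) • a), z - a⟫ / normM M a -
      3 / 4 * normM M (z - a) ^ 2 / m ^ 2 ≤ cosM M z s - cosM M a s := by
  obtain ⟨A, hA⟩ := exists_innerM_eq_inner hM
  have hN := normM_eq_norm hA
  have h := cos_sub_cos_ge (A s) (A a) (A z) m (by rw [← hN, hs]) hm (by rwa [← hN])
    (by rwa [← hN])
  rw [inner_app_left hM.1]
  rw [cosM_comm hM.1 z, cosM_comm hM.1 a, cosM, cosM, hs, one_mul, one_mul]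
  have h2 : ⟪s - (innerM M s a / normM M a ^ 2) • a, app M (z - a)⟫ =
      ⟪A s - (⟪A s, A a⟫ / ‖A a‖ ^ 2) • A a, A z - A a⟫ := by
    rw [← innerM, hA, map_sub, map_sub, map_smul, hA, hN]
  rw [h2, hN, hN, hN, hA, hA, map_sub]
  exact h

lemma abs_cosM_sub_cosM_le [Nonempty (Fin d)] (hM : M.PosDef) {s w z : Vec d}
    (hs : normM M s = 1) (hz : z ≠ 0) :
    |cosM M w s - cosM M z s| ≤ 2 * normM M (w - z) / normM M z := by
  obtain ⟨A, hA⟩ := exists_innerM_eq_inner hM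
  have hN := normM_eq_norm hA
  have hz' : A z ≠ 0 := by
    rw [← norm_pos_iff, ← hN]
    exact normM_pos hM hz
  have h := abs_cos_sub_cos_le (A s) (A w) (A z) (by rw [← hN, hs]) hz'
  rw [cosM_comm hM.1 w, cosM_comm hM.1 z, cosM, cosM, hs, one_mul, one_mul, hN, hN, hN, hA, hA,
    map_sub]
  exact h

end CosineLinear

/-! ### What the choices of `γ`, `κ`, `τ` and `α_*` achieve -/

section Quantities

variable {d : ℕ} {μ : Measure (Vec d)} {β ε : ℝ} {θs ψ θ₀ : Vec d}

lemma rpow_three_halves {x : ℝ} (hx : 0 < x) : x ^ (3 / 2 : ℝ) = x * √x := by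
  rw [show (3 / 2 : ℝ) = 1 + 1 / 2 by norm_num, Real.rpow_add hx, Real.rpow_one, Real.sqrt_eq_rpow]

lemma gam_pos (hL : 0 < lamMax (covMat μ)) (hβ : 0 < β) : 0 < gam μ β := by
  unfold gam; positivity

lemma gam_le_one (hL : 0 < lamMax (covMat μ)) (hβ : 0 < β) : gam μ β ≤ 1 := by
  unfold gam
  rw [div_le_one (by positivity)]
  linarith

/-- With `K = λmax β²/4` one has `γ = K/(K + 1)`: an iterate with `K‖θ - θ₀‖ ≤ γ‖θ₀‖` therefore
keeps norm at least `γ‖θ₀‖`. -/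
lemma gam_eq (hL : 0 < lamMax (covMat μ)) (hβ : 0 < β) :
    gam μ β / (lamMax (covMat μ) * β ^ 2 / 4) = 1 - gam μ β := by
  unfold gam
  field_simp
  ring

lemma kap_pos (hL : 0 < lamMax (covMat μ)) (hl : 0 < lamMin (covMat μ)) : 0 < kap μ β := by
  unfold kap
  positivity

lemma le_kap (hL : 0 < lamMax (covMat μ)) (hl : 0 < lamMin (covMat μ)) :
    9 / 8 * (lamMax (covMat μ) / lamMin (covMat μ)) +
      lamMax (covMat μ) * β ^ 2 / 4 * (√(lamMax (covMat μ)) / √(lamMin (covMat μ))) ≤ kap μ β := by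
  unfold kap
  rw [rpow_three_halves hL, ← Real.sqrt_eq_rpow]
  have h1 : (9 / 8 : ℝ) ≤ 2 / √3 := by
    rw [le_div_iff₀ (by positivity)]
    nlinarith [Real.sq_sqrt (show (0:ℝ) ≤ 3 by norm_num), Real.sqrt_nonneg 3]
  refine add_le_add (by gcongr) (le_of_eq (by ring))

lemma tau_nonneg (hL : 0 < lamMax (covMat μ)) (hl : 0 < lamMin (covMat μ)) (hβ : 0 < β)
    (hρ : 0 < rho μ β ε θs ψ θ₀) (hG : 0 < gradNorm μ β ψ θ₀) : 0 ≤ tau μ β ε θs ψ θ₀ := by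
  have hγ := gam_pos hL hβ
  have hκ := kap_pos (β := β) hL hl
  unfold tau
  refine le_min (mul_nonneg (by positivity) (Real.log_nonneg ?_)) (by positivity)
  have : 0 ≤ gam μ β * ‖θ₀‖ / gradNorm μ β ψ θ₀ := by positivity
  linarith

lemma exp_mul_tau_le (hL : 0 < lamMax (covMat μ)) (hβ : 0 < β)
    (hG : 0 < gradNorm μ β ψ θ₀) :
    Real.exp (lamMax (covMat μ) * β ^ 2 / 4 * tau μ β ε θs ψ θ₀) ≤
      gam μ β * ‖θ₀‖ / gradNorm μ β ψ θ₀ + 1 := by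
  have hγ := gam_pos hL hβ
  have h0 : 0 < gam μ β * ‖θ₀‖ / gradNorm μ β ψ θ₀ + 1 := by positivity
  rw [← Real.le_log_iff_exp_le h0]
  have h1 : tau μ β ε θs ψ θ₀ ≤
      4 / (lamMax (covMat μ) * β ^ 2) * Real.log (gam μ β * ‖θ₀‖ / gradNorm μ β ψ θ₀ + 1) :=
    min_le_left _ _
  calc _ ≤ lamMax (covMat μ) * β ^ 2 / 4 * (4 / (lamMax (covMat μ) * β ^ 2) *
        Real.log (gam μ β * ‖θ₀‖ / gradNorm μ β ψ θ₀ + 1)) := by gcongr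
    _ = _ := by field_simp

/-- The second branch of `tau`: the second order loss, of size `τ²κD²/(γ‖θ₀‖)²`, is at most `τ`
times the linear rate on the right. -/
lemma tau_mul_le (hL : 0 < lamMax (covMat μ)) (hl : 0 < lamMin (covMat μ)) (hβ : 0 < β)
    (hθ : 0 < ‖θ₀‖) (hG : 0 < gradNorm μ β ψ θ₀) :
    tau μ β ε θs ψ θ₀ * (kap μ β * (gradNorm μ β ψ θ₀ + gam μ β * ‖θ₀‖) ^ 2 /
      (gam μ β * ‖θ₀‖) ^ 2) ≤ β * rho μ β ε θs ψ θ₀ / (√(lamMax (covMat μ)) * ‖θ₀‖) := by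
  have hγ := gam_pos hL hβ
  have hκ := kap_pos (β := β) hL hl
  have hs := Real.sqrt_pos.mpr hL
  have h1 : tau μ β ε θs ψ θ₀ ≤ β * rho μ β ε θs ψ θ₀ * gam μ β ^ 2 * ‖θ₀‖ /
      (√(lamMax (covMat μ)) * kap μ β * (gradNorm μ β ψ θ₀ + gam μ β * ‖θ₀‖) ^ 2) := by
    rw [Real.sqrt_eq_rpow]
    exact min_le_right _ _
  calc _ ≤ β * rho μ β ε θs ψ θ₀ * gam μ β ^ 2 * ‖θ₀‖ /
      (√(lamMax (covMat μ)) * kap μ β * (gradNorm μ β ψ θ₀ + gam μ β * ‖θ₀‖) ^ 2) *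
        (kap μ β * (gradNorm μ β ψ θ₀ + gam μ β * ‖θ₀‖) ^ 2 / (gam μ β * ‖θ₀‖) ^ 2) := by gcongr
    _ = _ := by field_simp

/-- Both branches of `alphaStar` are those of `tau` times half the linear rate. -/
lemma alphaStar_eq (hL : 0 < lamMax (covMat μ)) (hl : 0 < lamMin (covMat μ)) (hβ : 0 < β)
    (hθ : 0 < ‖θ₀‖) (hρ : 0 < rho μ β ε θs ψ θ₀) (hG : 0 < gradNorm μ β ψ θ₀) :
    alphaStar μ β ε θs ψ θ₀ = tau μ β ε θs ψ θ₀ *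
      (β * rho μ β ε θs ψ θ₀ / (√(lamMax (covMat μ)) * ‖θ₀‖) / 2) := by
  have hγ := gam_pos hL hβ
  have hκ := kap_pos (β := β) hL hl
  have hs := Real.sqrt_pos.mpr hL
  have hss := Real.sq_sqrt hL.le
  unfold alphaStar tau
  rw [rpow_three_halves hL, ← Real.sqrt_eq_rpow, min_mul_of_nonneg _ _ (by positivity)]
  have e1 : ∀ l : ℝ, 2 * rho μ β ε θs ψ θ₀ /
      (lamMax (covMat μ) * √(lamMax (covMat μ)) * β * ‖θ₀‖) * l =
      4 / (lamMax (covMat μ) * β ^ 2) * l *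
        (β * rho μ β ε θs ψ θ₀ / (√(lamMax (covMat μ)) * ‖θ₀‖) / 2) := fun l => by
    field_simp
    ring
  have e2 : β * rho μ β ε θs ψ θ₀ * gam μ β ^ 2 * ‖θ₀‖ /
      (√(lamMax (covMat μ)) * kap μ β * (gradNorm μ β ψ θ₀ + gam μ β * ‖θ₀‖) ^ 2) *
        (β * rho μ β ε θs ψ θ₀ / (√(lamMax (covMat μ)) * ‖θ₀‖) / 2) =
      β ^ 2 * rho μ β ε θs ψ θ₀ ^ 2 * gam μ β ^ 2 /
      (2 * √(lamMax (covMat μ)) ^ 2 * kap μ β *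
        (gradNorm μ β ψ θ₀ + gam μ β * ‖θ₀‖) ^ 2) := by
    field_simp
  rw [hss] at e2
  rw [e1, e2]

end Quantities

/-! ### The gradient descent trajectory and its gain -/

section Trajectory

variable {d : ℕ} [Nonempty (Fin d)] {μ : Measure (Vec d)} {β ε : ℝ}
  {E : Submodule ℝ (Vec d)} {θs ψ θ₀ : Vec d}

lemma one_add_pow_le (hM : (covMat μ).PosDef) (hβ : 0 < β) (hρ : 0 < rho μ β ε θs ψ θ₀)
    (hG : 0 < gradNorm μ β ψ θ₀) {T t : ℕ} (hT : 1 ≤ T) (ht : t ≤ T) :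
    (1 + tau μ β ε θs ψ θ₀ / T * (lamMax (covMat μ) * β ^ 2 / 4)) ^ t ≤
      gam μ β * ‖θ₀‖ / gradNorm μ β ψ θ₀ + 1 := by
  have hL := lamMax_pos hM
  have hτ := tau_nonneg hL (lamMin_pos hM) hβ hρ hG
  refine le_trans ?_ (exp_mul_tau_le (ε := ε) (θs := θs) hL hβ hG)
  have hT' : (0 : ℝ) < T := by exact_mod_cast hT
  set x := tau μ β ε θs ψ θ₀ / T * (lamMax (covMat μ) * β ^ 2 / 4) with hx
  have hx0 : 0 ≤ x := by positivity
  calc (1 + x) ^ t ≤ (1 + x) ^ T := pow_le_pow_right₀ (by linarith) ht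
    _ ≤ Real.exp x ^ T := pow_le_pow_left₀ (by linarith) (by linarith [Real.add_one_le_exp x]) _
    _ = _ := by
      rw [← Real.exp_nat_mul, hx]
      congr 1
      field_simp

variable [IsProbabilityMeasure μ]

/-- A critical point would have rate of improvement zero, contradicting `IsElliptical.rho_le` with
`ρ > 0`. This makes the divisions by `G` genuine. -/
lemma IsElliptical.gradNorm_pos (h : IsElliptical μ ε E) (hε : 0 ≤ ε) (hβ : 0 < β) (hψE : ψ ∈ E)
    (hθE : θ₀ ∈ E) (hs : normM (covMat μ) θs = 1) (hψ : normM (covMat μ) ψ = 1) (hθ : θ₀ ≠ 0)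
    (hsψ : 0 ≤ innerM (covMat μ ^ 2) θs ψ) (hsθ : 0 ≤ innerM (covMat μ) θs θ₀)
    (hρ : 0 < rho μ β ε θs ψ θ₀) : 0 < gradNorm μ β ψ θ₀ := by
  rw [gradNorm_eq h.memLp_two hβ, norm_pos_iff]
  intro h0
  have := h.rho_le hε hβ hψE hθE hs hψ hθ hsψ hsθ
  rw [h0, inner_zero_right, neg_zero] at this
  linarith [mul_pos hβ hρ]

lemma norm_gd_ge (h2 : MemLp id 2 μ) (h0 : ∫ x, x ∂μ = 0) (hM : (covMat μ).PosDef) (hβ : 0 < β)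
    (hρ : 0 < rho μ β ε θs ψ θ₀) (hG : 0 < gradNorm μ β ψ θ₀) {T t : ℕ} (hT : 1 ≤ T)
    (ht : t ≤ T) :
    lamMax (covMat μ) * β ^ 2 / 4 *
        ‖gd (popGrad μ β ψ) (tau μ β ε θs ψ θ₀ / T) θ₀ t - θ₀‖ ≤ gam μ β * ‖θ₀‖ ∧
      ‖popGrad μ β ψ (gd (popGrad μ β ψ) (tau μ β ε θs ψ θ₀ / T) θ₀ t)‖ ≤
        gradNorm μ β ψ θ₀ + gam μ β * ‖θ₀‖ ∧
      gam μ β * ‖θ₀‖ ≤ ‖gd (popGrad μ β ψ) (tau μ β ε θs ψ θ₀ / T) θ₀ t‖ := by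
  have hL := lamMax_pos hM
  have hτ := tau_nonneg hL (lamMin_pos hM) hβ hρ hG
  have hg := norm_popGrad_sub_le h2 h0 hM hL.le hβ ψ
  have hη : 0 ≤ tau μ β ε θs ψ θ₀ / T := by positivity
  have h1 := norm_gd_sub_le_geom (θ₀ := θ₀) hη (by positivity) hg t
  have h3 := one_add_pow_le hM hβ hρ hG hT ht
  rw [← gradNorm_eq h2 hβ] at h1
  set θ := gd (popGrad μ β ψ) (tau μ β ε θs ψ θ₀ / T) θ₀ t
  have h4 : lamMax (covMat μ) * β ^ 2 / 4 * ‖θ - θ₀‖ ≤ gam μ β * ‖θ₀‖ := by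
    refine h1.trans ?_
    calc _ ≤ gradNorm μ β ψ θ₀ * (gam μ β * ‖θ₀‖ / gradNorm μ β ψ θ₀) := by
          gcongr; linarith
      _ = _ := by field_simp
  refine ⟨h4, ?_, ?_⟩
  · have := norm_add_le (popGrad μ β ψ θ₀) (popGrad μ β ψ θ - popGrad μ β ψ θ₀)
    rw [add_sub_cancel, ← gradNorm_eq h2 hβ ψ θ₀] at this
    linarith [hg θ θ₀]
  · have h5 : ‖θ - θ₀‖ ≤ (1 - gam μ β) * ‖θ₀‖ := by
      rw [← gam_eq hL hβ, div_mul_eq_mul_div, le_div_iff₀ (by positivity), mul_comm]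
      exact h4
    have := norm_sub_norm_le θ₀ (θ₀ - θ)
    rw [sub_sub_cancel, norm_sub_rev] at this
    linarith

/-- Gradient descent on the population loss improves the cosine with `θs`. -/
lemma IsElliptical.gd_gain (h : IsElliptical μ ε E) (hε : 0 ≤ ε) (hβ : 0 < β) (hψE : ψ ∈ E)
    (hθE : θ₀ ∈ E) (hs : normM (covMat μ) θs = 1) (hψ : normM (covMat μ) ψ = 1) (hθ : θ₀ ≠ 0)
    (hsψ : 0 ≤ innerM (covMat μ ^ 2) θs ψ) (hsθ : 0 ≤ innerM (covMat μ) θs θ₀)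
    (hρ : 0 < rho μ β ε θs ψ θ₀) {T : ℕ} (hT : 1 ≤ T) :
    2 / 3 * alphaStar μ β ε θs ψ θ₀ ≤
      cosM (covMat μ) (gd (popGrad μ β ψ) (tau μ β ε θs ψ θ₀ / T) θ₀ T) θs -
        cosM (covMat μ) θ₀ θs := by
  have h2 := h.memLp_two
  have h0 := h.mean_zero
  have hM := h.posDef
  have hL := lamMax_pos hM
  have hl := lamMin_pos hM
  have hG := h.gradNorm_pos hε hβ hψE hθE hs hψ hθ hsψ hsθ hρ
  have hn : 0 < ‖θ₀‖ := norm_pos_iff.mpr hθ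
  have hγ := gam_pos hL hβ
  have hγ1 := gam_le_one hL hβ
  have hτ := tau_nonneg hL hl hβ hρ hG
  have hτS := tau_mul_le (ε := ε) (θs := θs) hL hl hβ hn hG
  have hκ := le_kap (β := β) hL hl
  have hrate := h.rho_le hε hβ hψE hθE hs hψ hθ hsψ hsθ
  have hαeq := alphaStar_eq hL hl hβ hn hρ hG
  have hg := norm_popGrad_sub_le h2 h0 hM hL.le hβ ψ
  have hη : 0 ≤ tau μ β ε θs ψ θ₀ / T := by positivity
  have hT' : (T : ℝ) ≠ 0 := by positivity
  have htraj := fun t (ht : t ≤ T) => norm_gd_ge h2 h0 hM hβ hρ hG hT ht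
  set D := gradNorm μ β ψ θ₀ + gam μ β * ‖θ₀‖ with hDdef
  have hD : 0 < D := by positivity
  have hd1 := norm_gd_sub_le hη (fun t (ht : t < T) => (htraj t ht.le).2.1)
  have hd2 := norm_gd_sub_add_le hη (K := lamMax (covMat μ) * β ^ 2 / 4) (by positivity) hD.le hg
    (fun t (ht : t < T) => (htraj t ht.le).2.1)
  have hend := (htraj T le_rfl).2.2
  rw [mul_div_cancel₀ _ hT'] at hd1 hd2
  set θ := gd (popGrad μ β ψ) (tau μ β ε θs ψ θ₀ / T) θ₀ T
  set τ := tau μ β ε θs ψ θ₀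
  set Λ := lamMax (covMat μ)
  set l := lamMin (covMat μ)
  set γ := gam μ β
  set n := ‖θ₀‖
  set N := normM (covMat μ) θ₀ with hNdef
  have hN : 0 < N := normM_pos hM hθ
  have hsL : 0 < √Λ := Real.sqrt_pos.mpr hL
  have hsl : 0 < √l := Real.sqrt_pos.mpr hl
  have hNle : N ≤ √Λ * n := normM_le hM θ₀
  have hNge : √l * n ≤ N := le_normM hM θ₀
  set v := app (covMat μ) (θs - (innerM (covMat μ) θs θ₀ / N ^ 2) • θ₀) with hv
  have hmain := cosM_sub_cosM_ge hM (s := θs) (a := θ₀) (z := θ) (m := √l * (γ * n)) hs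
    (by positivity) ((mul_le_mul_of_nonneg_left (mul_le_of_le_one_left hn.le hγ1) hsl.le).trans hNge)
    ((mul_le_mul_of_nonneg_left hend hsl.le).trans (le_normM hM θ))
  rw [← hNdef, ← hv] at hmain
  have hvn : ‖v‖ ≤ √Λ := by
    refine (norm_app_le hM _).trans (mul_le_of_le_one_right hsL.le ?_)
    have h1 := normM_projPerp_le hM θ₀ θs
    rw [projPerp, hs, innerM_comm hM.1 θ₀ θs, ← normM_sq hM] at h1
    exact h1
  -- The displacement is `-τ∇L(θ₀)` up to the error in `hd2`; `‖v‖ ≤ √λmax` converts that error.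
  have hlin : τ * (β * rho μ β ε θs ψ θ₀) - √Λ * (Λ * β ^ 2 / 4 * D * τ ^ 2 / 2) ≤
      ⟪v, θ - θ₀⟫ := by
    have e : ⟪v, θ - θ₀⟫ = τ * (-⟪v, popGrad μ β ψ θ₀⟫) +
        ⟪v, θ - θ₀ + τ • popGrad μ β ψ θ₀⟫ := by
      rw [inner_add_right, real_inner_smul_right]; ring
    have h1 := abs_real_inner_le_norm v (θ - θ₀ + τ • popGrad μ β ψ θ₀)
    have h3 := mul_le_mul hvn hd2 (norm_nonneg _) hsL.le
    have h4 := mul_le_mul_of_nonneg_left hrate hτ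
    rw [e]
    linarith [neg_abs_le ⟪v, θ - θ₀ + τ • popGrad μ β ψ θ₀⟫]
  have hquad : normM (covMat μ) (θ - θ₀) ^ 2 ≤ Λ * (τ * D) ^ 2 := by
    calc _ ≤ (√Λ * (τ * D)) ^ 2 := by
          refine pow_le_pow_left₀ (normM_nonneg _ _) ?_ 2
          exact (normM_le hM _).trans (by gcongr)
      _ = _ := by rw [mul_pow, Real.sq_sqrt hL.le]
  have hlin2 : τ * (β * rho μ β ε θs ψ θ₀ / (√Λ * n)) -
      τ ^ 2 / 2 * (Λ * β ^ 2 / 4 * (√Λ / √l) * (D / n)) ≤ ⟪v, θ - θ₀⟫ / N := by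
    have h1 : τ * (β * rho μ β ε θs ψ θ₀) / (√Λ * n) ≤ τ * (β * rho μ β ε θs ψ θ₀) / N := by
      gcongr
    have h3 : √Λ * (Λ * β ^ 2 / 4 * D * τ ^ 2 / 2) / N ≤
        √Λ * (Λ * β ^ 2 / 4 * D * τ ^ 2 / 2) / (√l * n) := by gcongr
    have h4 := div_le_div_of_nonneg_right hlin hN.le
    rw [sub_div] at h4
    have h5 : √Λ * (Λ * β ^ 2 / 4 * D * τ ^ 2 / 2) / (√l * n) =
      τ ^ 2 / 2 * (Λ * β ^ 2 / 4 * (√Λ / √l) * (D / n)) := by field_simp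
    rw [mul_div_assoc] at h1
    linarith
  have hquad2 : 3 / 4 * normM (covMat μ) (θ - θ₀) ^ 2 / (√l * (γ * n)) ^ 2 ≤
      τ ^ 2 / 2 * (3 / 2 * (Λ / l * (D ^ 2 / (γ * n) ^ 2))) := by
    calc _ ≤ 3 / 4 * (Λ * (τ * D) ^ 2) / (√l * (γ * n)) ^ 2 := by gcongr
      _ = _ := by
        rw [mul_pow (√l), Real.sq_sqrt hl.le]
        field_simp
        ring
  -- This puts the curvature of the trajectory and that of the cosine over the common factor
  -- `D²/(γn)²`.
  have hDn : D / n ≤ D ^ 2 / (γ * n) ^ 2 := by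
    rw [div_le_div_iff₀ hn (by positivity)]
    have h1 : γ * n ≤ D := by linarith
    have h3 : (γ * n) ^ 2 ≤ D * n := by
      rw [pow_two]
      exact mul_le_mul h1 (mul_le_of_le_one_left hn.le hγ1) (by positivity) hD.le
    calc D * (γ * n) ^ 2 ≤ D * (D * n) := by gcongr
      _ = _ := by ring
  -- `3/2 = (4/3)(9/8)` and `9/8 ≤ 2/√3`, which is how `κ` absorbs both terms.
  have hκ2 : Λ * β ^ 2 / 4 * (√Λ / √l) * (D / n) + 3 / 2 * (Λ / l * (D ^ 2 / (γ * n) ^ 2)) ≤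
      4 / 3 * (kap μ β * D ^ 2 / (γ * n) ^ 2) := by
    have h1 := mul_le_mul_of_nonneg_left hDn (show 0 ≤ Λ * β ^ 2 / 4 * (√Λ / √l) by positivity)
    have h3 := mul_le_mul_of_nonneg_right hκ (show 0 ≤ D ^ 2 / (γ * n) ^ 2 by positivity)
    have h4 : 0 ≤ Λ * β ^ 2 / 4 * (√Λ / √l) * (D ^ 2 / (γ * n) ^ 2) := by positivity
    rw [mul_div_assoc (kap μ β)]
    linarith
  -- With `R = βρ/(√Λ n)`, the total loss is at most `(2/3)τ · τκD²/(γn)² ≤ (2/3)τR`. This leaves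
  -- `τR/3 = (2/3)α_*`.
  have hfin := mul_le_mul_of_nonneg_left hκ2 (show 0 ≤ τ ^ 2 / 2 by positivity)
  have hfin2 := mul_le_mul_of_nonneg_left hτS hτ
  rw [hαeq]
  linarith

end Trajectory

end WeakToStrong

namespace WeakToStrong

/-! ### Variance of a minibatch average -/

section MinibatchVariance

variable {α : Type*} [MeasurableSpace α] {μ : Measure α} [IsProbabilityMeasure μ] {B : ℕ}

lemma memLp_eval {F : Type*} [NormedAddCommGroup F] {f : α → F} (hf : MemLp f 2 μ) (i : Fin B) :
    MemLp (fun y : Fin B → α => f (y i)) 2 (Measure.pi fun _ => μ) :=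
  hf.comp_measurePreserving (measurePreserving_eval (fun _ : Fin B => μ) i)

lemma integral_eval {F : Type*} [NormedAddCommGroup F] [NormedSpace ℝ F] {f : α → F}
    (hf : MemLp f 2 μ) (i : Fin B) :
    ∫ y : Fin B → α, f (y i) ∂(Measure.pi fun _ => μ) = ∫ x, f x ∂μ := by
  have h := measurePreserving_eval (fun _ : Fin B => μ) i
  conv_rhs => rw [← h.map_eq]
  rw [integral_map h.measurable.aemeasurable]
  rw [h.map_eq]
  exact hf.aestronglyMeasurable

/-- The second moment of a shifted minibatch average. -/
lemma integral_sq_shifted_mean_le (hB : 1 ≤ B) {f : α → ℝ} (hf : MemLp f 2 μ) (p η : ℝ) :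
    ∫ y : Fin B → α, (p - η * (1 / (B : ℝ) * ∑ i, f (y i) - ∫ x, f x ∂μ)) ^ 2
        ∂(Measure.pi fun _ => μ) ≤
      p ^ 2 + η ^ 2 / B * ∫ x, f x ^ 2 ∂μ := by
  have hB' : (B : ℝ) ≠ 0 := by positivity
  set ν : Measure (Fin B → α) := Measure.pi fun _ => μ
  set S : (Fin B → α) → ℝ := fun y => ∑ i, f (y i) with hS
  have hSm : MemLp S 2 ν := memLp_finsetSum _ fun i _ => memLp_eval hf i
  have hSi : Integrable S ν := hSm.integrable one_le_two
  have hES : ∫ y, S y ∂ν = B * ∫ x, f x ∂μ := by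
    rw [hS, integral_finsetSum _ fun i _ => (memLp_eval hf i).integrable one_le_two]
    simp [integral_eval hf]
  have hVar : ∫ y, (S y - B * ∫ x, f x ∂μ) ^ 2 ∂ν ≤ B * ∫ x, f x ^ 2 ∂μ := by
    rw [← hES, ← variance_eq_integral hSm.aemeasurable]
    have h1 : S = ∑ i, fun y : Fin B → α => f (y i) := by
      funext y
      simp [hS]
    rw [h1, variance_sum_pi (X := fun _ : Fin B => f) (μ := fun _ => μ) fun _ => hf]
    simp only [Finset.sum_const, Finset.card_univ, Fintype.card_fin, nsmul_eq_mul]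
    gcongr
    exact variance_le_expectation_sq hf.aestronglyMeasurable
  -- Expansion around the mean: the cross term integrates to zero by `hz`, and the square is the
  -- variance of an independent sum.
  have hexp : ∀ y, (p - η * (1 / (B : ℝ) * S y - ∫ x, f x ∂μ)) ^ 2 =
      p ^ 2 - 2 * p * η / B * (S y - B * ∫ x, f x ∂μ) +
        η ^ 2 / B ^ 2 * (S y - B * ∫ x, f x ∂μ) ^ 2 := fun y => by
    field_simp
    ring
  have hi1 : Integrable (fun y => S y - B * ∫ x, f x ∂μ) ν := hSi.sub (integrable_const _)
  have hi2 : Integrable (fun y => (S y - B * ∫ x, f x ∂μ) ^ 2) ν :=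
    (hSm.sub (memLp_const _)).integrable_sq
  have hz : ∫ y, (S y - B * ∫ x, f x ∂μ) ∂ν = 0 := by
    rw [integral_sub hSi (integrable_const _), hES]
    simp
  change ∫ y, (p - η * (1 / (B : ℝ) * S y - ∫ x, f x ∂μ)) ^ 2 ∂ν ≤ _
  simp only [hexp]
  have hi3 : Integrable (fun y => p ^ 2 - 2 * p * η / B * (S y - B * ∫ x, f x ∂μ)) ν :=
    (integrable_const _).sub (hi1.const_mul _)
  rw [integral_add hi3 (hi2.const_mul _), integral_sub (integrable_const _) (hi1.const_mul _), integral_const_mul, integral_const_mul, hz]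
  simp only [integral_const, probReal_univ, one_smul, mul_zero, sub_zero]
  refine add_le_add le_rfl ?_
  calc _ ≤ η ^ 2 / (B : ℝ) ^ 2 * (B * ∫ x, f x ^ 2 ∂μ) := by gcongr
    _ = _ := by field_simp

variable {d : ℕ}

lemma memLp_shifted_mean {f : α → Vec d} (hf : MemLp f 2 μ) (p : Vec d) (η : ℝ) :
    MemLp (fun y : Fin B → α => p - η • ((1 / (B : ℝ)) • ∑ i, f (y i) - ∫ x, f x ∂μ)) 2
      (Measure.pi fun _ => μ) :=
  (memLp_const p).sub
    ((((memLp_finsetSum _ fun i _ => memLp_eval hf i).const_smul (1 / (B : ℝ))).sub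
      (memLp_const _)).const_smul η)

lemma integral_norm_sq_shifted_mean_le (hB : 1 ≤ B) {f : α → Vec d} (hf : MemLp f 2 μ)
    (p : Vec d) (η : ℝ) :
    ∫ y : Fin B → α, ‖p - η • ((1 / (B : ℝ)) • ∑ i, f (y i) - ∫ x, f x ∂μ)‖ ^ 2
        ∂(Measure.pi fun _ => μ) ≤
      ‖p‖ ^ 2 + η ^ 2 / B * ∫ x, ‖f x‖ ^ 2 ∂μ := by
  have hk : ∀ k, MemLp (fun x => f x k) 2 μ := fun k =>
    (EuclideanSpace.proj (𝕜 := ℝ) k).comp_memLp' hf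
  have hint : ∀ k, (∫ x, f x ∂μ) k = ∫ x, f x k ∂μ := fun k =>
    ((EuclideanSpace.proj (𝕜 := ℝ) k).integral_comp_comm (hf.integrable one_le_two)).symm
  have hQ := memLp_shifted_mean (B := B) hf p η
  have hQk : ∀ k, MemLp (fun y : Fin B → α =>
      (p - η • ((1 / (B : ℝ)) • ∑ i, f (y i) - ∫ x, f x ∂μ)) k) 2 (Measure.pi fun _ => μ) :=
    fun k => (EuclideanSpace.proj (𝕜 := ℝ) k).comp_memLp' hQ
  simp only [EuclideanSpace.norm_sq_eq, Real.norm_eq_abs, sq_abs]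
  rw [integral_finsetSum _ fun k _ => (hQk k).integrable_sq,
    integral_finsetSum _ fun k _ => (hk k).integrable_sq, Finset.mul_sum, ← Finset.sum_add_distrib]
  refine Finset.sum_le_sum fun k _ => ?_
  have h := integral_sq_shifted_mean_le hB (hk k) (p k) η
  simpa [hint] using h

end MinibatchVariance

/-! ### Measurability of the iterates and independence from the next batch -/

section SgdMeasurability

variable {d B : ℕ} {β η : ℝ} {ψ θ₀ : Vec d}

lemma sgd_congr {x x' : ℕ → Fin B → Vec d} {t : ℕ} (h : ∀ s < t, x s = x' s) :
    sgd β η ψ θ₀ x t = sgd β η ψ θ₀ x' t := by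
  induction t with
  | zero => rfl
  | succ t ih =>
    rw [sgd, sgd, ih fun s hs => h s (hs.trans t.lt_succ_self), h t t.lt_succ_self]

lemma measurable_sgd_step {α : Type*} [MeasurableSpace α] {w : α → Vec d}
    {y : α → Fin B → Vec d} (hw : Measurable w) (hy : ∀ i, Measurable fun a => y a i) :
    Measurable fun a => w a - η • batchGrad β ψ (y a) (w a) := by
  simp only [batchGrad_eq]
  have h : Measurable fun a => ∑ i, sampleGrad β ψ (w a) (y a i) :=
    Finset.measurable_fun_sum _ fun i _ => measurable_sampleGrad β ψ hw (hy i)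
  exact hw.sub ((h.fun_const_smul _).fun_const_smul _)

lemma measurable_sgd {α : Type*} [MeasurableSpace α] {x : α → ℕ → Fin B → Vec d}
    (hx : ∀ s i, Measurable fun a => x a s i) (t : ℕ) :
    Measurable fun a => sgd β η ψ θ₀ (x a) t := by
  induction t with
  | zero => exact measurable_const
  | succ t ih => exact measurable_sgd_step ih (hx t)

variable {T : ℕ} {Ω : Type*} {X : ℕ → Fin B → Ω → Vec d}

/-- The iterate at time `t` is a measurable function of the batches before time `t`. -/
lemma exists_sgd_eq (t : Fin T) : ∃ Φ : ((Finset.univ.filter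
      fun p : Fin T × Fin B => p.1 < t : Finset (Fin T × Fin B)) → Vec d) → Vec d,
    Measurable Φ ∧ ∀ ω, sgd β η ψ θ₀ (fun s i => X s i ω) t = Φ (fun p => X p.1.1 p.1.2 ω) := by
  classical
  -- Batches from time `t` on are filled with `0`; by `sgd_congr` the iterate at time `t` never
  -- reads them.
  refine ⟨fun u => sgd β η ψ θ₀
    (fun s i => if h : ∃ hs : s < T, (⟨s, hs⟩ : Fin T) < t then
    u ⟨(⟨s, h.1⟩, i), by simpa using h.2⟩ else 0) t, measurable_sgd (fun s i => ?_) _, fun ω => ?_⟩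
  · split_ifs with h
    · exact measurable_pi_apply _
    · exact measurable_const
  · refine sgd_congr fun s hs => ?_
    funext i
    have h : ∃ hs : s < T, (⟨s, hs⟩ : Fin T) < t := ⟨hs.trans t.2, hs⟩
    rw [dif_pos h]

variable [MeasurableSpace Ω] {P : Measure Ω} {μ : Measure (Vec d)}

lemma aemeasurable_sgd (hlaw : ∀ t < T, ∀ i, HasLaw (X t i) μ P) {t : ℕ} (ht : t ≤ T) :
    AEMeasurable (fun ω => sgd β η ψ θ₀ (fun s i => X s i ω) t) P := by
  have hΦ : Measurable fun u : Fin T → Fin B → Vec d =>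
      sgd β η ψ θ₀ (fun s i => if h : s < T then u ⟨s, h⟩ i else 0) t := by
    refine measurable_sgd (fun s i => ?_) t
    split_ifs with h
    · exact (measurable_pi_apply i).comp (measurable_pi_apply _)
    · exact measurable_const
  have h := hΦ.comp_aemeasurable (μ := P) (f := fun ω (s : Fin T) i => X s i ω)
    (aemeasurable_pi_lambda _ fun s => aemeasurable_pi_lambda _ fun i => (hlaw s s.2 i).aemeasurable)
  refine h.congr (Filter.Eventually.of_forall fun ω => sgd_congr fun s hs => ?_)
  funext i
  simp [hs.trans_le ht]

/-- The iterate and the fresh batch are functions of disjoint blocks of the independent family. -/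
lemma indepFun_sgd_batch (hlaw : ∀ t < T, ∀ i, HasLaw (X t i) μ P)
    (hind : iIndepFun (fun p : Fin T × Fin B => X p.1 p.2) P) {t : ℕ} (ht : t < T) :
    IndepFun (fun ω => sgd β η ψ θ₀ (fun s i => X s i ω) t) (fun ω i => X t i ω) P := by
  classical
  obtain ⟨Φ, hΦ, hΦeq⟩ := exists_sgd_eq (β := β) (η := η) (ψ := ψ) (θ₀ := θ₀) (X := X) ⟨t, ht⟩
  have h := hind.indepFun_finset₀
    (Finset.univ.filter fun p : Fin T × Fin B => p.1 < ⟨t, ht⟩)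
    (Finset.univ.filter fun p : Fin T × Fin B => p.1 = ⟨t, ht⟩)
    (Finset.disjoint_filter.mpr fun p _ h1 h2 => h1.ne h2)
    (fun p => (hlaw p.1 p.1.2 p.2).aemeasurable)
  have h2 := h.comp hΦ (ψ := fun u i => u ⟨(⟨t, ht⟩, i), by simp⟩)
    (measurable_pi_lambda _ fun i => measurable_pi_apply _)
  have e : (fun ω => sgd β η ψ θ₀ (fun s i => X s i ω) t) = _ := funext hΦeq
  rw [e]
  exact h2

variable [IsProbabilityMeasure P]

lemma map_batch (hlaw : ∀ t < T, ∀ i, HasLaw (X t i) μ P)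
    (hind : iIndepFun (fun p : Fin T × Fin B => X p.1 p.2) P) {t : ℕ} (ht : t < T) :
    P.map (fun ω i => X t i ω) = Measure.pi fun _ => μ := by
  have h : iIndepFun (fun i => X t i) P :=
    hind.precomp (g := fun i : Fin B => ((⟨t, ht⟩ : Fin T), i))
      fun i j hij => (Prod.ext_iff.mp hij).2
  rw [(iIndepFun_iff_map_fun_eq_pi_map fun i => (hlaw t ht i).aemeasurable).mp h]
  congr 1
  funext i
  exact (hlaw t ht i).map_eq

end SgdMeasurability

/-! ### Mean square deviation of SGD from gradient descent -/

section SgdDeviation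

variable {d B : ℕ} {β η : ℝ} {ψ θ₀ : Vec d} {μ : Measure (Vec d)} [IsProbabilityMeasure μ]

/-- One step of SGD stays close, in mean square, to one step of gradient descent. -/
lemma lintegral_sgd_step_le (hB : 1 ≤ B) (h2 : MemLp id 2 μ) (h0 : ∫ x, x ∂μ = 0)
    (hM : (covMat μ).PosDef) (hL : 0 ≤ lamMax (covMat μ)) (hβ : 0 < β) (hη : 0 ≤ η)
    (w θ : Vec d) :
    ∫⁻ y : Fin B → Vec d, ENNReal.ofReal
        (‖w - η • batchGrad β ψ y w - (θ - η • popGrad μ β ψ θ)‖ ^ 2) ∂(Measure.pi fun _ => μ) ≤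
      ENNReal.ofReal ((1 + η * (lamMax (covMat μ) * β ^ 2 / 4)) ^ 2 * ‖w - θ‖ ^ 2 +
        η ^ 2 / B * (β ^ 2 * (d * lamMax (covMat μ)))) := by
  set p := w - η • popGrad μ β ψ w - (θ - η • popGrad μ β ψ θ) with hp
  have hf := memLp_sampleGrad h2 hβ ψ w
  -- Deterministic drift `p`, which expands `‖w - θ‖` by at most `1 + ηK`, minus centred minibatch
  -- noise.
  have e : ∀ y : Fin B → Vec d, w - η • batchGrad β ψ y w - (θ - η • popGrad μ β ψ θ) =
      p - η • ((1 / (B : ℝ)) • ∑ i, sampleGrad β ψ w (y i) - ∫ x, sampleGrad β ψ w x ∂μ) :=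
    fun y => by
      rw [batchGrad_eq, hp, ← popGrad]
      module
  simp only [e]
  rw [← ofReal_integral_eq_lintegral_ofReal
    ((memLp_shifted_mean hf p η).integrable_norm_pow two_ne_zero)
    (Filter.Eventually.of_forall fun y => sq_nonneg _)]
  refine ENNReal.ofReal_le_ofReal
    ((integral_norm_sq_shifted_mean_le hB hf p η).trans (add_le_add ?_ ?_))
  · rw [← mul_pow]
    refine pow_le_pow_left₀ (norm_nonneg _) ?_ 2
    have e2 : p = (w - θ) - η • (popGrad μ β ψ w - popGrad μ β ψ θ) := by
      rw [hp]; module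
    rw [e2]
    refine (norm_sub_le _ _).trans ?_
    rw [norm_smul, Real.norm_of_nonneg hη]
    have := mul_le_mul_of_nonneg_left (norm_popGrad_sub_le h2 h0 hM hL hβ ψ w θ) hη
    linarith
  · exact mul_le_mul_of_nonneg_left (integral_norm_sampleGrad_sq_le h2 h0 hM hβ ψ w) (by positivity)

variable {T : ℕ} {Ω : Type*} [MeasurableSpace Ω] {P : Measure Ω} [IsProbabilityMeasure P]
  {X : ℕ → Fin B → Ω → Vec d}

/-- The mean squared distance between SGD and gradient descent on the population loss. -/
lemma lintegral_sgd_sub_gd_le (hB : 1 ≤ B) (h2 : MemLp id 2 μ) (h0 : ∫ x, x ∂μ = 0)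
    (hM : (covMat μ).PosDef) (hL : 0 ≤ lamMax (covMat μ)) (hβ : 0 < β) (hη : 0 ≤ η)
    (hlaw : ∀ t < T, ∀ i, HasLaw (X t i) μ P)
    (hind : iIndepFun (fun p : Fin T × Fin B => X p.1 p.2) P) {t : ℕ} (ht : t ≤ T) :
    ∫⁻ ω, ENNReal.ofReal (‖sgd β η ψ θ₀ (fun s i => X s i ω) t - gd (popGrad μ β ψ) η θ₀ t‖ ^ 2) ∂P ≤
      ENNReal.ofReal (t * ((1 + η * (lamMax (covMat μ) * β ^ 2 / 4)) ^ t) ^ 2 *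
        (η ^ 2 / B * (β ^ 2 * (d * lamMax (covMat μ))))) := by
  set a := 1 + η * (lamMax (covMat μ) * β ^ 2 / 4) with ha
  set V := η ^ 2 / B * (β ^ 2 * (d * lamMax (covMat μ))) with hV
  have ha1 : 1 ≤ a := by
    have : 0 ≤ η * (lamMax (covMat μ) * β ^ 2 / 4) := by positivity
    linarith
  have hV0 : 0 ≤ V := by positivity
  induction t with
  | zero => simp [sgd, gd]
  | succ t ih =>
    have ht' : t < T := ht
    set H : Vec d × (Fin B → Vec d) → ENNReal := fun q => ENNReal.ofReal
      (‖q.1 - η • batchGrad β ψ q.2 q.1 - gd (popGrad μ β ψ) η θ₀ (t + 1)‖ ^ 2) with hH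
    have hHm : Measurable H := by
      have : Measurable fun q : Vec d × (Fin B → Vec d) => q.1 - η • batchGrad β ψ q.2 q.1 :=
        measurable_sgd_step measurable_fst fun i => (measurable_pi_apply i).comp measurable_snd
      exact (((this.sub_const _).norm).pow_const 2).ennreal_ofReal
    have hm1 := aemeasurable_sgd (β := β) (η := η) (ψ := ψ) (θ₀ := θ₀) hlaw ht'.le
    have hm2 : AEMeasurable (fun ω i => X t i ω) P :=
      aemeasurable_pi_lambda _ fun i => (hlaw t ht' i).aemeasurable
    -- The joint law is a product, so Tonelli lets the one-step bound be applied with the current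
    -- iterate frozen at `w`.
    have hjoint := (indepFun_iff_map_prod_eq_prod_map_map hm1 hm2).mp
      (indepFun_sgd_batch hlaw hind ht')
    rw [map_batch hlaw hind ht'] at hjoint
    have hN : Measurable fun w : Vec d =>
        ENNReal.ofReal (‖w - gd (popGrad μ β ψ) η θ₀ t‖ ^ 2) := by fun_prop
    calc ∫⁻ ω, H (sgd β η ψ θ₀ (fun s i => X s i ω) t, fun i => X t i ω) ∂P
        = ∫⁻ q, H q ∂((P.map fun ω => sgd β η ψ θ₀ (fun s i => X s i ω) t).prod
            (Measure.pi fun _ => μ)) := by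
          rw [← hjoint, lintegral_map' hHm.aemeasurable (hm1.prodMk hm2)]
      _ = ∫⁻ w, ∫⁻ y, H (w, y) ∂(Measure.pi fun _ => μ)
            ∂(P.map fun ω => sgd β η ψ θ₀ (fun s i => X s i ω) t) :=
          lintegral_prod _ hHm.aemeasurable
      _ ≤ ∫⁻ w, (ENNReal.ofReal (a ^ 2) *
            ENNReal.ofReal (‖w - gd (popGrad μ β ψ) η θ₀ t‖ ^ 2) + ENNReal.ofReal V)
            ∂(P.map fun ω => sgd β η ψ θ₀ (fun s i => X s i ω) t) := by
          refine lintegral_mono fun w => ?_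
          rw [← ENNReal.ofReal_mul (by positivity), ← ENNReal.ofReal_add (by positivity) hV0]
          exact lintegral_sgd_step_le hB h2 h0 hM hL hβ hη w _
      _ = ENNReal.ofReal (a ^ 2) * ∫⁻ ω, ENNReal.ofReal
            (‖sgd β η ψ θ₀ (fun s i => X s i ω) t - gd (popGrad μ β ψ) η θ₀ t‖ ^ 2) ∂P +
            ENNReal.ofReal V := by
          have hN' : AEMeasurable (fun ω => ENNReal.ofReal
            (‖sgd β η ψ θ₀ (fun s i => X s i ω) t - gd (popGrad μ β ψ) η θ₀ t‖ ^ 2)) P :=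
            hN.comp_aemeasurable hm1
          rw [lintegral_map' (by fun_prop) hm1, lintegral_add_right _ measurable_const,
            lintegral_const_mul'' _ hN', lintegral_const, measure_univ,
            mul_one]
      _ ≤ ENNReal.ofReal (a ^ 2) * ENNReal.ofReal (t * (a ^ t) ^ 2 * V) + ENNReal.ofReal V := by
          gcongr
          exact ih ht'.le
      _ ≤ _ := by
          rw [← ENNReal.ofReal_mul (by positivity), ← ENNReal.ofReal_add (by positivity) hV0]
          refine ENNReal.ofReal_le_ofReal ?_
          -- The new noise `V` is enlarged to `a^(2(t+1)) V`, so that all `t + 1` contributions are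
          -- alike.
          have h1 : 1 ≤ (a ^ (t + 1)) ^ 2 := one_le_pow₀ (one_le_pow₀ ha1)
          have h3 := mul_le_mul_of_nonneg_right h1 hV0
          push_cast
          calc a ^ 2 * (t * (a ^ t) ^ 2 * V) + V = t * (a ^ (t + 1)) ^ 2 * V + 1 * V := by ring
            _ ≤ _ := by linarith

end SgdDeviation

end WeakToStrong

namespace WeakToStrong

/-! ### Assembling the probability bound -/

section Guarantee

variable {d : ℕ} {μ : Measure (Vec d)} {β ε : ℝ} {θs ψ θ₀ : Vec d}

lemma tau_mul_sq_le (hL : 0 < lamMax (covMat μ)) (hβ : 0 < β) (hG : 0 < gradNorm μ β ψ θ₀) :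
    tau μ β ε θs ψ θ₀ * (β ^ 2 * lamMax (covMat μ)) ≤
      4 * (gam μ β * ‖θ₀‖ / gradNorm μ β ψ θ₀) := by
  have h := exp_mul_tau_le (ε := ε) (θs := θs) (ψ := ψ) (θ₀ := θ₀) hL hβ hG
  have h1 := Real.add_one_le_exp (lamMax (covMat μ) * β ^ 2 / 4 * tau μ β ε θs ψ θ₀)
  linarith

variable [Nonempty (Fin d)]

lemma alphaStar_pos (hM : (covMat μ).PosDef) (hβ : 0 < β) (hθ : θ₀ ≠ 0)
    (hρ : 0 < rho μ β ε θs ψ θ₀) (hG : 0 < gradNorm μ β ψ θ₀) :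
    0 < alphaStar μ β ε θs ψ θ₀ := by
  have hL := lamMax_pos hM
  have hγ := gam_pos hL hβ
  have hκ := kap_pos (β := β) hL (lamMin_pos hM)
  have hn : 0 < ‖θ₀‖ := norm_pos_iff.mpr hθ
  have hlog : 0 < Real.log (gam μ β * ‖θ₀‖ / gradNorm μ β ψ θ₀ + 1) := by
    refine Real.log_pos ?_
    have : 0 < gam μ β * ‖θ₀‖ / gradNorm μ β ψ θ₀ := by positivity
    linarith
  unfold alphaStar
  exact lt_min (by positivity) (by positivity)

lemma delta_pos (hM : (covMat μ).PosDef) (hβ : 0 < β) (hθ : θ₀ ≠ 0)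
    (hρ : 0 < rho μ β ε θs ψ θ₀) (hG : 0 < gradNorm μ β ψ θ₀) :
    0 < delta μ β ε θs ψ θ₀ := by
  have hL := lamMax_pos hM
  have hl := lamMin_pos hM
  have hγ := gam_pos hL hβ
  have hα := alphaStar_pos hM hβ hθ hρ hG
  have hn : 0 < ‖θ₀‖ := norm_pos_iff.mpr hθ
  unfold delta
  positivity

/-- A parameter within `delta` of the endpoint of gradient descent has almost its cosine. -/
lemma abs_cosM_sub_le_of_norm_sub_le (hM : (covMat μ).PosDef) (hβ : 0 < β)
    (hs : normM (covMat μ) θs = 1) (hθ : θ₀ ≠ 0) {w z : Vec d} (hz : gam μ β * ‖θ₀‖ ≤ ‖z‖)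
    (hw : ‖w - z‖ ≤ delta μ β ε θs ψ θ₀) :
    |cosM (covMat μ) w θs - cosM (covMat μ) z θs| ≤ alphaStar μ β ε θs ψ θ₀ / 4 := by
  have hL := lamMax_pos hM
  have hl := lamMin_pos hM
  have hγ := gam_pos hL hβ
  have hn : 0 < ‖θ₀‖ := norm_pos_iff.mpr hθ
  have hsL := Real.sqrt_pos.mpr hL
  have hsl := Real.sqrt_pos.mpr hl
  have hz0 : z ≠ 0 := norm_pos_iff.mp ((mul_pos hγ hn).trans_le hz)
  refine (abs_cosM_sub_cosM_le hM hs hz0).trans ?_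
  have h1 : normM (covMat μ) (w - z) ≤ √(lamMax (covMat μ)) * delta μ β ε θs ψ θ₀ :=
    (normM_le hM _).trans (by gcongr)
  have h2 : √(lamMin (covMat μ)) * (gam μ β * ‖θ₀‖) ≤ normM (covMat μ) z :=
    (mul_le_mul_of_nonneg_left hz hsl.le).trans (le_normM hM z)
  have h3 : 0 ≤ √(lamMax (covMat μ)) * delta μ β ε θs ψ θ₀ := (normM_nonneg _ _).trans h1
  calc 2 * normM (covMat μ) (w - z) / normM (covMat μ) z
      ≤ 2 * (√(lamMax (covMat μ)) * delta μ β ε θs ψ θ₀) /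
          (√(lamMin (covMat μ)) * (gam μ β * ‖θ₀‖)) := by gcongr
    _ = _ := by
      unfold delta
      rw [← Real.sqrt_eq_rpow, ← Real.sqrt_eq_rpow]
      field_simp
      ring

lemma sqrt_div_sqrt_le (hM : (covMat μ).PosDef) :
    √(lamMax (covMat μ)) / √(lamMin (covMat μ)) ≤ lamMax (covMat μ) / lamMin (covMat μ) := by
  have hl := lamMin_pos hM
  rw [← Real.sqrt_div (lamMax_pos hM).le]
  have h1 : 1 ≤ lamMax (covMat μ) / lamMin (covMat μ) := by
    rw [one_le_div hl]
    exact lamMin_le_lamMax hM.1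
  refine Real.sqrt_le_iff.mpr ⟨by linarith, ?_⟩
  exact le_self_pow₀ h1 two_ne_zero

/-- The Chebyshev bound on the deviation of SGD, expressed in the quantities of the guarantee. -/
lemma chebyshev_bound_le (hM : (covMat μ).PosDef) (hβ : 0 < β) (hθ : θ₀ ≠ 0)
    (hρ : 0 < rho μ β ε θs ψ θ₀) (hG : 0 < gradNorm μ β ψ θ₀) {T B : ℕ} (hT : 1 ≤ T) (hB : 1 ≤ B)
    (hη : tau μ β ε θs ψ θ₀ / T ≤ etaMax μ β ε θs ψ θ₀) :
    T * ((1 + tau μ β ε θs ψ θ₀ / T * (lamMax (covMat μ) * β ^ 2 / 4)) ^ T) ^ 2 *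
        ((tau μ β ε θs ψ θ₀ / T) ^ 2 / B * (β ^ 2 * (d * lamMax (covMat μ)))) /
        delta μ β ε θs ψ θ₀ ^ 2 ≤
      d / (B * alphaStar μ β ε θs ψ θ₀) *
        (256 * ((β ^ 2 * lamMax (covMat μ) + 1) / (β ^ 2 * lamMin (covMat μ)) *
          (1 / (‖θ₀‖ * gradNorm μ β ψ θ₀) + 1 / gradNorm μ β ψ θ₀ ^ 2))) := by
  have hL := lamMax_pos hM
  have hl := lamMin_pos hM
  have hγ := gam_pos hL hβ
  have hγ1 := gam_le_one hL hβ
  have hα := alphaStar_pos hM hβ hθ hρ hG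
  have hδ := delta_pos hM hβ hθ hρ hG
  have hn : 0 < ‖θ₀‖ := norm_pos_iff.mpr hθ
  have hτ := tau_nonneg hL hl hβ hρ hG
  have hgrow := one_add_pow_le hM hβ hρ hG hT le_rfl
  have hτ4 := tau_mul_sq_le (ε := ε) (θs := θs) (ψ := ψ) (θ₀ := θ₀) hL hβ hG
  have hratio := sqrt_div_sqrt_le hM
  have hsL := Real.sqrt_pos.mpr hL
  have hsl := Real.sqrt_pos.mpr hl
  have hδeq : delta μ β ε θs ψ θ₀ = gam μ β * ‖θ₀‖ * √(lamMin (covMat μ)) *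
      alphaStar μ β ε θs ψ θ₀ / (8 * √(lamMax (covMat μ))) := by
    rw [delta, ← Real.sqrt_eq_rpow, ← Real.sqrt_eq_rpow]
  have hγinv : lamMax (covMat μ) / lamMin (covMat μ) / gam μ β ≤
      4 * ((β ^ 2 * lamMax (covMat μ) + 1) / (β ^ 2 * lamMin (covMat μ))) := by
    unfold gam
    have : lamMax (covMat μ) / lamMin (covMat μ) /
        (lamMax (covMat μ) * β ^ 2 / (lamMax (covMat μ) * β ^ 2 + 4)) =
        (lamMax (covMat μ) * β ^ 2 + 4) / (β ^ 2 * lamMin (covMat μ)) := by field_simp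
    rw [this, mul_div_assoc']
    gcongr
    have : 0 ≤ β ^ 2 * lamMax (covMat μ) := by positivity
    linarith
  unfold etaMax at hη
  have hT' : (0 : ℝ) < T := by positivity
  have hB' : (0 : ℝ) < B := by positivity
  set τ := tau μ β ε θs ψ θ₀
  set δ := delta μ β ε θs ψ θ₀
  set α := alphaStar μ β ε θs ψ θ₀
  set Λ := lamMax (covMat μ)
  set l := lamMin (covMat μ)
  set γ := gam μ β
  set n := ‖θ₀‖
  set G := gradNorm μ β ψ θ₀
  set a := (1 + τ / T * (Λ * β ^ 2 / 4)) ^ T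
  have ha : 0 ≤ a := by positivity
  have hη' : τ / T ≤ δ * (2 * G / (γ * n * (G + γ * n))) := by
    refine hη.trans (le_of_eq ?_)
    congr 1
    field_simp
  have hgrow' : a ≤ (G + γ * n) / G := by
    refine hgrow.trans (le_of_eq ?_)
    field_simp
    ring
  -- One factor `τ/T` is spent on the step size threshold, which cancels one `δ`; the other joins
  -- `T` to give `τ`, bounded by `tau_mul_sq_le`. The remaining `1/δ` supplies `1/α` and a factor
  -- `8`, and `hγinv` a factor `4`: `8 · 8 · 4 = 256`.
  calc T * a ^ 2 * ((τ / T) ^ 2 / B * (β ^ 2 * (d * Λ))) / δ ^ 2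
      = a ^ 2 * (τ / T) * (τ * (β ^ 2 * Λ)) * d / B / δ ^ 2 := by field_simp
    _ ≤ ((G + γ * n) / G) ^ 2 * (δ * (2 * G / (γ * n * (G + γ * n)))) * (4 * (γ * n / G)) *
          d / B / δ ^ 2 := by gcongr
    _ = 8 * (G + γ * n) / G ^ 2 * d / B / δ := by
        field_simp
        ring
    _ = d / (B * α) * (64 * ((√Λ / √l) / γ * (1 / (n * G) + γ * (1 / G ^ 2)))) := by
        rw [hδeq]
        field_simp
        ring
    _ ≤ d / (B * α) * (64 * (4 * ((β ^ 2 * Λ + 1) / (β ^ 2 * l)) *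
          (1 / (n * G) + 1 / G ^ 2))) := by
        gcongr
        · exact (div_le_div_of_nonneg_right hratio hγ.le).trans hγinv
        · exact mul_le_of_le_one_left (by positivity) hγ1
    _ = _ := by ring

end Guarantee

/-- Stochastic gradient descent improves the cosine, with high probability. -/
lemma IsElliptical.sgd_gain {d : ℕ} [Nonempty (Fin d)] {μ : Measure (Vec d)}
    [IsProbabilityMeasure μ] {β ε : ℝ} {θs ψ θ₀ : Vec d} {T B : ℕ} {E : Submodule ℝ (Vec d)}
    (h : IsElliptical μ ε E) (hε : 0 ≤ ε) (hβ : 0 < β) (hψE : ψ ∈ E)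
    (hθE : θ₀ ∈ E) (hs : normM (covMat μ) θs = 1) (hψ : normM (covMat μ) ψ = 1) (hθ : θ₀ ≠ 0)
    (hsψ : 0 ≤ innerM (covMat μ ^ 2) θs ψ) (hsθ : 0 ≤ innerM (covMat μ) θs θ₀)
    (hρ : 0 < rho μ β ε θs ψ θ₀) (hT : 1 ≤ T) (hB : 1 ≤ B)
    (hη : tau μ β ε θs ψ θ₀ / T ≤ etaMax μ β ε θs ψ θ₀)
    {Ω : Type*} [MeasurableSpace Ω] {P : Measure Ω} [IsProbabilityMeasure P]
    {X : ℕ → Fin B → Ω → Vec d} (hlaw : ∀ t < T, ∀ i, HasLaw (X t i) μ P)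
    (hind : iIndepFun (fun p : Fin T × Fin B => X p.1 p.2) P) :
    P.real {ω | ¬ (1 / 4 * alphaStar μ β ε θs ψ θ₀ ≤
        cosM (covMat μ) (sgd β (tau μ β ε θs ψ θ₀ / T) ψ θ₀ (fun t i => X t i ω) T) θs
          - cosM (covMat μ) θ₀ θs)} ≤
      d / (B * alphaStar μ β ε θs ψ θ₀) *
        (256 * ((β ^ 2 * lamMax (covMat μ) + 1) / (β ^ 2 * lamMin (covMat μ)) *
          (1 / (‖θ₀‖ * gradNorm μ β ψ θ₀) + 1 / gradNorm μ β ψ θ₀ ^ 2))) := by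
  have hM := h.posDef
  have hL := lamMax_pos hM
  have hl := lamMin_pos hM
  have hG := h.gradNorm_pos hε hβ hψE hθE hs hψ hθ hsψ hsθ hρ
  have hα := alphaStar_pos hM hβ hθ hρ hG
  have hδ := delta_pos hM hβ hθ hρ hG
  have hτ := tau_nonneg hL hl hβ hρ hG
  have hη0 : 0 ≤ tau μ β ε θs ψ θ₀ / T := by positivity
  have hgain := h.gd_gain hε hβ hψE hθE hs hψ hθ hsψ hsθ hρ hT
  have hend := (norm_gd_ge h.memLp_two h.mean_zero hM hβ hρ hG hT le_rfl).2.2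
  refine le_trans ?_ (chebyshev_bound_le hM hβ hθ hρ hG hT hB hη)
  have hdev := lintegral_sgd_sub_gd_le (ψ := ψ) (θ₀ := θ₀) hB h.memLp_two h.mean_zero hM hL.le hβ
    hη0 hlaw hind le_rfl
  have hmeas : AEMeasurable (fun ω => ENNReal.ofReal
      (‖sgd β (tau μ β ε θs ψ θ₀ / T) ψ θ₀ (fun s i => X s i ω) T -
        gd (popGrad μ β ψ) (tau μ β ε θs ψ θ₀ / T) θ₀ T‖ ^ 2)) P :=
    (((aemeasurable_sgd hlaw le_rfl).sub_const _).norm.pow_const 2).ennreal_ofReal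
  set z := gd (popGrad μ β ψ) (tau μ β ε θs ψ θ₀ / T) θ₀ T
  set bound := T * ((1 + tau μ β ε θs ψ θ₀ / T * (lamMax (covMat μ) * β ^ 2 / 4)) ^ T) ^ 2 *
    ((tau μ β ε θs ψ θ₀ / T) ^ 2 / B * (β ^ 2 * (d * lamMax (covMat μ))))
  have hbound : 0 ≤ bound := by positivity
  refine ENNReal.toReal_le_of_le_ofReal (by positivity) ?_
  have hδ2 : 0 < delta μ β ε θs ψ θ₀ ^ 2 := by positivity
  -- On the complement SGD ends within `δ` of `z`, so its gain is at least `(2/3 - 1/4)α_*`;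
  -- Markov's inequality for the squared distance does the rest.
  calc P _ ≤ P {ω | ENNReal.ofReal (delta μ β ε θs ψ θ₀ ^ 2) ≤ ENNReal.ofReal
          (‖sgd β (tau μ β ε θs ψ θ₀ / T) ψ θ₀ (fun s i => X s i ω) T - z‖ ^ 2)} := by
        refine measure_mono fun ω hω => ?_
        by_contra hlt
        simp only [Set.mem_ofPred_eq, not_le] at hlt hω
        have h1 := (ENNReal.ofReal_lt_ofReal_iff hδ2).mp hlt
        have h2 := abs_cosM_sub_le_of_norm_sub_le hM hβ hs hθ hend
          (lt_of_pow_lt_pow_left₀ 2 hδ.le h1).le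
        linarith [(abs_le.mp h2).1]
    _ ≤ (∫⁻ ω, ENNReal.ofReal
          (‖sgd β (tau μ β ε θs ψ θ₀ / T) ψ θ₀ (fun s i => X s i ω) T - z‖ ^ 2) ∂P) /
          ENNReal.ofReal (delta μ β ε θs ψ θ₀ ^ 2) :=
        meas_ge_le_lintegral_div hmeas (by simpa using hδ.ne') ENNReal.ofReal_ne_top
    _ ≤ ENNReal.ofReal bound / ENNReal.ofReal (delta μ β ε θs ψ θ₀ ^ 2) := by gcongr
    _ = _ := (ENNReal.ofReal_div_of_pos hδ2).symm

end WeakToStrong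

theorem mainTheorem2 :
    ∃ c > (0 : ℝ), ∃ C > (0 : ℝ),
      ∀ (d : ℕ) (μ : Measure (WeakToStrong.Vec d)) [IsProbabilityMeasure μ]
        (β ε : ℝ) (θs ψ θ₀ : WeakToStrong.Vec d) (T B : ℕ),
        0 < β → 0 ≤ ε →
        WeakToStrong.normM (WeakToStrong.covMat μ) θs = 1 →
        WeakToStrong.normM (WeakToStrong.covMat μ) ψ = 1 →
        θ₀ ≠ 0 →
        0 ≤ WeakToStrong.innerM (WeakToStrong.covMat μ ^ 2) θs θ₀ →
        0 ≤ WeakToStrong.innerM (WeakToStrong.covMat μ) θs θ₀ →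
        0 ≤ WeakToStrong.innerM (WeakToStrong.covMat μ ^ 2) θs ψ →
        WeakToStrong.IsElliptical μ ε (Submodule.span ℝ {ψ, θ₀}) →
        0 < WeakToStrong.rho μ β ε θs ψ θ₀ →
        1 ≤ T → 1 ≤ B →
        WeakToStrong.tau μ β ε θs ψ θ₀ / T ≤ WeakToStrong.etaMax μ β ε θs ψ θ₀ →
        ∀ (Ω : Type*) [MeasurableSpace Ω] (P : Measure Ω) [IsProbabilityMeasure P]
          (X : ℕ → Fin B → Ω → WeakToStrong.Vec d),
          (∀ t < T, ∀ i, HasLaw (X t i) μ P) →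
          iIndepFun (fun p : Fin T × Fin B => X p.1 p.2) P →
          P.real {ω | ¬ (c * WeakToStrong.alphaStar μ β ε θs ψ θ₀ ≤
              WeakToStrong.cosM (WeakToStrong.covMat μ)
                (WeakToStrong.sgd β (WeakToStrong.tau μ β ε θs ψ θ₀ / T) ψ θ₀
                  (fun t i => X t i ω) T) θs
              - WeakToStrong.cosM (WeakToStrong.covMat μ) θ₀ θs)} ≤
            d / (B * WeakToStrong.alphaStar μ β ε θs ψ θ₀) *
              (C * ((β ^ 2 * WeakToStrong.lamMax (WeakToStrong.covMat μ) + 1) /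
                  (β ^ 2 * WeakToStrong.lamMin (WeakToStrong.covMat μ)) *
                (1 / (‖θ₀‖ * WeakToStrong.gradNorm μ β ψ θ₀)
                  + 1 / WeakToStrong.gradNorm μ β ψ θ₀ ^ 2))) := by
  refine ⟨1 / 4, by norm_num, 256, by norm_num, ?_⟩
  intro d μ _ β ε θs ψ θ₀ T B hβ hε hs hψ hθ _ hsθ hsψ h hρ hT hB hη Ω _ P _ X hlaw hind
  -- Dimension zero is excluded by `θ₀ ≠ 0`; otherwise the spectrum would be empty.
  have hne : Nonempty (Fin d) := by
    by_contra hd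
    rw [not_nonempty_iff] at hd
    exact hθ (Subsingleton.elim _ _)
  exact h.sgd_gain hε hβ (Submodule.subset_span (by simp)) (Submodule.subset_span (by simp))
    hs hψ hθ hsψ hsθ hρ hT hB hη hlaw hind
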